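/- **Proposition 3.2.** Let $I\subset\mathbb R$ be an open interval, let $f:I\to\mathbb R$ be smooth and positive, and let $\bar M^{n+1}=I\times\mathbb S^n$ carry the warped product metric $dt^2+f(t)^2d\sigma^2$, where $d\sigma^2$ is the standard metric of the unit sphere $\mathbb S^n\subset\mathbb R^{n+1}$. Let $\mathbf x:M^k\to\bar M$ be an isometric immersion of a $k$-dimensional Riemannian manifold, and write $\partial_t=T+\varrho$ along $\mathbf x$, with $T$ tangent and $\varrho$ normal to $M$. Let $\bar\nabla$ and $\nabla$ be the Levi-Civita connections of $\bar M$ and $M$, $R$ the curvature tensor of $M$, $\alpha(u,v)=(\bar\nabla_u v)^\perp$ the second fundamental form, $\nabla^\perp_u\xi=(\bar\nabla_u\xi)^\perp$ the normal connection and $R^\perp$ its curvature tensor, and let $A_\xi$ be given by $\langle A_\xi u,v\rangle=\langle\alpha(u,v),\xi\rangle$. For both connections, $R(u,v)=\nabla_u\nabla_v-\nabla_v\nabla_u-\nabla_{[u,v]}$, and $$(\nabla^\perp_u\alpha)(v,w)=\nabla^\perp_u(\alpha(v,w))-\alpha(\nabla_uv,w)-\alpha(v,\nabla_uw).$$ Put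 $(a,b,c,d)=\langle b,c\rangle\langle a,d\rangle-\langle a,c\rangle\langle b,d\rangle$ and $$\lambda(t)=\frac{1-f'(t)^2}{f(t)^2},\qquad \mu(t)=\frac{1-f'(t)^2}{f(t)^2}+\frac{f''(t)}{f(t)},$$ evaluated at the $I$-coordinate $t$ of $\mathbf x$. Then for all $u,v,w,z\in TM$ and $\xi,\eta\in TM^\perp$ the Gauss, Codazzi and Ricci equations of $\mathbf x$ are, respectively, $$\begin{aligned}\langle R(u,v)w,z\rangle={}&\lambda(t)\,(u,v,w,z)+\mu(t)\big[\langle w,T\rangle(v,u,T,z)+(v,u,w,T)\langle T,z\rangle\big]\\&+\langle\alpha(u,z),\alpha(v,w)\rangle-\langle\alpha(u,w),\alpha(v,z)\rangle,\end{aligned}$$ $$(\nabla^\perp_u\alpha)(v,w)-(\nabla^\perp_v\alpha)(u,w)=\mu(t)\,(v,u,w,T)\,\varrho,$$ $$\langle R^\perp(u,v)\xi,\eta\rangle=\langle[A_\xi,A_\eta]u,v\rangle .$$ -/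

import Mathlib

open Bundle Manifold FiberBundle
open scoped ContDiff Topology

set_option linter.unusedSectionVars false

noncomputable section

namespace SubmanifoldGeometry

section LeviCivita

variable {E : Type*} [NormedAddCommGroup E] [NormedSpace ℝ E] [FiniteDimensional ℝ E]
  {H : Type*} [TopologicalSpace H] (I : ModelWithCorners ℝ E H)
  {M : Type*} [TopologicalSpace M] [ChartedSpace H M]
  [RiemannianBundle (fun p : M => TangentSpace I p)]

/-- The Koszul expression, which equals `2 ⟨∇_X Y, Z⟩` for the Levi-Civita connection `∇`:
`X⟨Y, Z⟩ + Y⟨Z, X⟩ - Z⟨X, Y⟩ + ⟨[X, Y], Z⟩ - ⟨[Y, Z], X⟩ + ⟨[Z, X], Y⟩`. -/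
def koszul (X Y Z : Π p : M, TangentSpace I p) (p : M) : ℝ :=
  d% (fun q => inner ℝ (Y q) (Z q)) p (X p) + d% (fun q => inner ℝ (Z q) (X q)) p (Y p)
    - d% (fun q => inner ℝ (X q) (Y q)) p (Z p)
    + inner ℝ (VectorField.mlieBracket I X Y p) (Z p)
    - inner ℝ (VectorField.mlieBracket I Y Z p) (X p)
    + inner ℝ (VectorField.mlieBracket I Z X p) (Y p)

variable {I}
variable [IsManifold I ∞ M]
  [IsContMDiffRiemannianBundle I ∞ E (fun p : M => TangentSpace I p)]
  {X X' Y Y' Z Z' : Π p : M, TangentSpace I p} {p : M} {g : M → ℝ}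

lemma mdifferentiableAt_inner (hX : MDiffAt (T% X) p) (hY : MDiffAt (T% Y) p) :
    MDiffAt (fun q => inner ℝ (X q) (Y q)) p :=
  MDifferentiableAt.inner_bundle (E := fun p : M => TangentSpace I p) (F := E) (b := id) hX hY

lemma koszul_swap (X Y Z : Π p : M, TangentSpace I p) (p : M) :
    koszul I X Y Z p + koszul I X Z Y p = 2 * d% (fun q => inner ℝ (Y q) (Z q)) p (X p) := by
  rw [koszul, koszul, VectorField.mlieBracket_swap_apply (V := Z) (W := Y),
    VectorField.mlieBracket_swap_apply (V := X) (W := Z),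
    VectorField.mlieBracket_swap_apply (V := Y) (W := X)]
  simp only [inner_neg_left]
  simp_rw [real_inner_comm (Y _) (Z _), real_inner_comm (X _) (Z _), real_inner_comm (X _) (Y _)]
  ring

lemma koszul_symm (X Y Z : Π p : M, TangentSpace I p) (p : M) :
    koszul I X Y Z p - koszul I Y X Z p = 2 * inner ℝ (VectorField.mlieBracket I X Y p) (Z p) := by
  rw [koszul, koszul, VectorField.mlieBracket_swap_apply (V := Y) (W := X),
    VectorField.mlieBracket_swap_apply (V := X) (W := Z),
    VectorField.mlieBracket_swap_apply (V := Z) (W := Y)]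
  simp only [inner_neg_left]
  simp_rw [real_inner_comm (Z _) (Y _), real_inner_comm (X _) (Z _), real_inner_comm (X _) (Y _)]
  ring

lemma koszul_smul_left
    (hg : MDiffAt g p) (hX : MDiffAt (T% X) p) (hY : MDiffAt (T% Y) p) (hZ : MDiffAt (T% Z) p) :
    koszul I (g • X) Y Z p = g p * koszul I X Y Z p := by
  have : CompleteSpace E := FiniteDimensional.complete ℝ E
  have h1 := mdifferentiableAt_inner hZ hX
  have h2 := mdifferentiableAt_inner hX hY
  simp [koszul, inner_smul_left, inner_smul_right, inner_add_left, mvfderiv_fun_mul hg h1,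
    mvfderiv_fun_mul hg h2, VectorField.mlieBracket_smul_left hg hX,
    VectorField.mlieBracket_smul_right hg hX]
  rw [real_inner_comm (Z p) (X p)]
  ring

lemma koszul_smul_right
    (hg : MDiffAt g p) (hX : MDiffAt (T% X) p) (hY : MDiffAt (T% Y) p) (hZ : MDiffAt (T% Z) p) :
    koszul I X Y (g • Z) p = g p * koszul I X Y Z p := by
  have : CompleteSpace E := FiniteDimensional.complete ℝ E
  have h1 := mdifferentiableAt_inner hY hZ
  have h2 := mdifferentiableAt_inner hZ hX
  simp [koszul, inner_smul_left, inner_smul_right, inner_add_left, mvfderiv_fun_mul hg h1,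
    mvfderiv_fun_mul hg h2, VectorField.mlieBracket_smul_left hg hZ,
    VectorField.mlieBracket_smul_right hg hZ]
  rw [real_inner_comm (Z p) (Y p)]
  ring

lemma koszul_smul_middle
    (hg : MDiffAt g p) (hX : MDiffAt (T% X) p) (hY : MDiffAt (T% Y) p) (hZ : MDiffAt (T% Z) p) :
    koszul I X (g • Y) Z p = g p * koszul I X Y Z p + 2 * (d% g p (X p) * inner ℝ (Y p) (Z p)) := by
  have : CompleteSpace E := FiniteDimensional.complete ℝ E
  have h1 := mdifferentiableAt_inner hY hZ
  have h2 := mdifferentiableAt_inner hX hY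
  simp [koszul, inner_smul_left, inner_smul_right, inner_add_left, mvfderiv_fun_mul hg h1,
    mvfderiv_fun_mul hg h2, VectorField.mlieBracket_smul_left hg hY,
    VectorField.mlieBracket_smul_right hg hY]
  rw [real_inner_comm (X p) (Y p)]
  ring

lemma koszul_add_left
    (hX : MDiffAt (T% X) p) (hX' : MDiffAt (T% X') p) (hY : MDiffAt (T% Y) p)
    (hZ : MDiffAt (T% Z) p) :
    koszul I (X + X') Y Z p = koszul I X Y Z p + koszul I X' Y Z p := by
  have : CompleteSpace E := FiniteDimensional.complete ℝ E
  simp [koszul, inner_add_left, inner_add_right,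
    mvfderiv_fun_add (mdifferentiableAt_inner hZ hX) (mdifferentiableAt_inner hZ hX'),
    mvfderiv_fun_add (mdifferentiableAt_inner hX hY) (mdifferentiableAt_inner hX' hY),
    VectorField.mlieBracket_add_left hX hX', VectorField.mlieBracket_add_right hX hX']
  ring

lemma koszul_add_middle
    (hX : MDiffAt (T% X) p) (hY : MDiffAt (T% Y) p) (hY' : MDiffAt (T% Y') p)
    (hZ : MDiffAt (T% Z) p) :
    koszul I X (Y + Y') Z p = koszul I X Y Z p + koszul I X Y' Z p := by
  have : CompleteSpace E := FiniteDimensional.complete ℝ E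
  simp [koszul, inner_add_left, inner_add_right,
    mvfderiv_fun_add (mdifferentiableAt_inner hY hZ) (mdifferentiableAt_inner hY' hZ),
    mvfderiv_fun_add (mdifferentiableAt_inner hX hY) (mdifferentiableAt_inner hX hY'),
    VectorField.mlieBracket_add_left hY hY', VectorField.mlieBracket_add_right hY hY']
  ring

lemma koszul_add_right
    (hX : MDiffAt (T% X) p) (hY : MDiffAt (T% Y) p)
    (hZ : MDiffAt (T% Z) p) (hZ' : MDiffAt (T% Z') p) :
    koszul I X Y (Z + Z') p = koszul I X Y Z p + koszul I X Y Z' p := by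
  have : CompleteSpace E := FiniteDimensional.complete ℝ E
  simp [koszul, inner_add_left, inner_add_right,
    mvfderiv_fun_add (mdifferentiableAt_inner hY hZ) (mdifferentiableAt_inner hY hZ'),
    mvfderiv_fun_add (mdifferentiableAt_inner hZ hX) (mdifferentiableAt_inner hZ' hX),
    VectorField.mlieBracket_add_left hZ hZ', VectorField.mlieBracket_add_right hZ hZ']
  ring

/-- The Koszul expression is tensorial in `X` and `Z`, and so gives a bilinear form on the
tangent space at `p`, for each vector field `Y` that is differentiable at `p`. -/
def koszulForm (Y : Π p : M, TangentSpace I p) (p : M) (hY : MDiffAt (T% Y) p) :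
    TangentSpace I p →L[ℝ] TangentSpace I p →L[ℝ] ℝ :=
  TensorialAt.mkHom₂ (I := I) (F := E) (F' := E) (V := fun p : M => TangentSpace I p)
    (V' := fun p : M => TangentSpace I p) (fun X Z => koszul I X Y Z p) p
    (fun _ hZ => ⟨fun hg hX => koszul_smul_left hg hX hY hZ,
      fun hX hX' => koszul_add_left hX hX' hY hZ⟩)
    (fun _ hX => ⟨fun hg hZ => koszul_smul_right hg hX hY hZ,
      fun hZ hZ' => koszul_add_right hX hY hZ hZ'⟩)

instance (p : M) : FiniteDimensional ℝ (TangentSpace I p) :=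
  inferInstanceAs (FiniteDimensional ℝ E)

instance (p : M) : CompleteSpace (TangentSpace I p) :=
  FiniteDimensional.complete ℝ _

lemma koszulForm_apply (hY : MDiffAt (T% Y) p) (hX : MDiffAt (T% X) p) (hZ : MDiffAt (T% Z) p) :
    koszulForm Y p hY (X p) (Z p) = koszul I X Y Z p :=
  TensorialAt.mkHom₂_apply _ _ hX hZ

/-- The endomorphism `u ↦ ∇_u Y` of the tangent space at `p`, given by the Koszul formula. -/
def leviCivitaAt (Y : Π p : M, TangentSpace I p) (p : M) (hY : MDiffAt (T% Y) p) :
    TangentSpace I p →L[ℝ] TangentSpace I p :=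
  LinearMap.toContinuousLinearMap
    { toFun := fun u =>
        (InnerProductSpace.toDual ℝ (TangentSpace I p)).symm ((1 / 2 : ℝ) • koszulForm Y p hY u)
      map_add' := fun u v => by simp
      map_smul' := fun c u => by simp [smul_smul, mul_comm] }

lemma inner_leviCivitaAt (hX : MDiffAt (T% X) p) (hY : MDiffAt (T% Y) p) (hZ : MDiffAt (T% Z) p) :
    inner ℝ (leviCivitaAt Y p hY (X p)) (Z p) = 1 / 2 * koszul I X Y Z p := by
  change inner ℝ ((InnerProductSpace.toDual ℝ (TangentSpace I p)).symm
    ((1 / 2 : ℝ) • koszulForm Y p hY (X p))) (Z p) = _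
  rw [InnerProductSpace.toDual_symm_apply, ← koszulForm_apply hY hX hZ]
  rfl

lemma leviCivitaAt_ext {A B : TangentSpace I p →L[ℝ] TangentSpace I p}
    (h : ∀ X Z : Π p : M, TangentSpace I p, MDiffAt (T% X) p → MDiffAt (T% Z) p →
      inner ℝ (A (X p)) (Z p) = inner ℝ (B (X p)) (Z p)) : A = B := by
  ext1 u
  refine ext_inner_right ℝ fun w => ?_
  have := h (extend E u) (extend E w) (mdifferentiableAt_extend ..) (mdifferentiableAt_extend ..)
  simpa using this

variable (I M) in
open Classical in
/-- The Levi-Civita connection of a Riemannian manifold, given by the Koszul formula: for `Y`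
differentiable at `p`, `leviCivita I M Y p u` is `∇_u Y` (the value at a point where `Y` is not
differentiable is irrelevant, and set to zero). It is metric and torsion-free, see
`leviCivita_metric` and `leviCivita_torsion_free` below. -/
def leviCivita : CovariantDerivative I E (TangentSpace I : M → Type _) where
  toFun Y p := if hY : MDiffAt (T% Y) p then leviCivitaAt Y p hY else 0
  isCovariantDerivativeOnUniv :=
    { add := by
        intro Y Y' p hY hY' _
        have h : MDiffAt (T% (Y + Y')) p := mdifferentiableAt_add_section hY hY'
        rw [dif_pos h, dif_pos hY, dif_pos hY']
        refine leviCivitaAt_ext fun X Z hX hZ => ?_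
        rw [_root_.add_apply, inner_add_left, inner_leviCivitaAt hX h hZ,
          inner_leviCivitaAt hX hY hZ, inner_leviCivitaAt hX hY' hZ,
          koszul_add_middle hX hY hY' hZ]
        ring
      leibniz := by
        intro Y g p hY hg _
        have h : MDiffAt (T% (g • Y)) p := hg.smul_section hY
        rw [dif_pos h, dif_pos hY]
        refine leviCivitaAt_ext fun X Z hX hZ => ?_
        rw [_root_.add_apply, inner_add_left, inner_leviCivitaAt hX h hZ,
          koszul_smul_middle hg hX hY hZ, _root_.smul_apply,
          real_inner_smul_left, inner_leviCivitaAt hX hY hZ, ContinuousLinearMap.smulRight_apply,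
          real_inner_smul_left]
        ring }

lemma inner_leviCivita (hX : MDiffAt (T% X) p) (hY : MDiffAt (T% Y) p) (hZ : MDiffAt (T% Z) p) :
    inner ℝ (leviCivita I M Y p (X p)) (Z p) = 1 / 2 * koszul I X Y Z p := by
  rw [← inner_leviCivitaAt hX hY hZ]
  simp [leviCivita, hY]

theorem leviCivita_metric (hX : MDiffAt (T% X) p) (hY : MDiffAt (T% Y) p) (hZ : MDiffAt (T% Z) p) :
    d% (fun q => inner ℝ (Y q) (Z q)) p (X p) =
      inner ℝ (leviCivita I M Y p (X p)) (Z p) + inner ℝ (Y p) (leviCivita I M Z p (X p)) := by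
  have h := koszul_swap (I := I) X Y Z p
  rw [real_inner_comm (leviCivita I M Z p (X p)), inner_leviCivita hX hY hZ,
    inner_leviCivita hX hZ hY]
  linarith

theorem leviCivita_torsion_free (hX : MDiffAt (T% X) p) (hY : MDiffAt (T% Y) p) :
    leviCivita I M Y p (X p) - leviCivita I M X p (Y p) = VectorField.mlieBracket I X Y p := by
  refine ext_inner_right ℝ fun w => ?_
  have hZ : MDiffAt (T% (extend E w)) p := mdifferentiableAt_extend ..
  have h1 := inner_leviCivita hX hY hZ
  have h2 := inner_leviCivita hY hX hZ
  have h := koszul_symm (I := I) X Y (extend E w) p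
  rw [extend_apply_self] at h1 h2 h
  rw [inner_sub_left, h1, h2]
  linarith
end LeviCivita

section Pullback

variable {E : Type*} [NormedAddCommGroup E] [NormedSpace ℝ E]
  {H : Type*} [TopologicalSpace H] {I : ModelWithCorners ℝ E H}
  {M : Type*} [TopologicalSpace M] [ChartedSpace H M]
  {F : Type*} [NormedAddCommGroup F] [InnerProductSpace ℝ F]

variable (I) in
/-- The pullback `(u, v) ↦ ⟨dφ(u), dφ(v)⟩` of the inner product of `F` by a map `φ : M → F`. -/
def pullbackInner (φ : M → F) (p : M) : TangentSpace I p →L[ℝ] TangentSpace I p →L[ℝ] ℝ :=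
  ((mvfderiv I φ p).precomp ℝ).comp ((innerSL ℝ : F →L[ℝ] F →L[ℝ] ℝ).comp (mvfderiv I φ p))

lemma pullbackInner_apply (φ : M → F) (p : M) (u v : TangentSpace I p) :
    pullbackInner I φ p u v = inner ℝ (mvfderiv I φ p u) (mvfderiv I φ p v) := rfl

lemma contMDiff_pullbackInner [IsManifold I ∞ M] {φ : M → F} (hφ : ContMDiff I 𝓘(ℝ, F) ∞ φ) :
    ContMDiff I (I.prod 𝓘(ℝ, E →L[ℝ] E →L[ℝ] ℝ)) ∞
      (fun p => TotalSpace.mk' (E →L[ℝ] E →L[ℝ] ℝ)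
        (E := fun p : M => TangentSpace I p →L[ℝ] TangentSpace I p →L[ℝ] ℝ)
        p (pullbackInner I φ p)) := by
  intro p
  rw [contMDiffAt_section]
  have hA := (hφ p).mfderiv_const (m := ∞) (by simp)
  set A : M → E →L[ℝ] F := inTangentCoordinates I 𝓘(ℝ, F) id φ (mfderiv I 𝓘(ℝ, F) φ) p with hAdef
  let B : F →L[ℝ] F →L[ℝ] ℝ := innerSL ℝ
  have h1 : ContMDiffAt I 𝓘(ℝ, E →L[ℝ] E →L[ℝ] ℝ) ∞
      (fun q => ((A q).precomp ℝ).comp (B.comp (A q))) p := by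
    have h2 : ContMDiffAt I 𝓘(ℝ, E →L[ℝ] F →L[ℝ] ℝ) ∞ (fun q => B.comp (A q)) p :=
      contMDiffAt_const.clm_comp hA
    have h3 : ContMDiffAt I 𝓘(ℝ, (F →L[ℝ] ℝ) →L[ℝ] E →L[ℝ] ℝ) ∞
      (fun q => ((A q).precomp ℝ : (F →L[ℝ] ℝ) →L[ℝ] E →L[ℝ] ℝ)) p :=
      ContMDiffAt.clm_precomp hA
    exact h3.clm_comp h2
  refine h1.congr_of_eventuallyEq ?_
  filter_upwards [(trivializationAt E (TangentSpace I) p).open_baseSet.mem_nhds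
    (mem_baseSet_trivializationAt E (TangentSpace I) p)] with q hq
  ext v w
  rw [hom_trivializationAt_apply]
  change ContinuousLinearMap.inCoordinates E (TangentSpace I) (E →L[ℝ] ℝ) _ p q p q _ v w = _
  rw [inCoordinates_apply_eq₂ (E₃ := Bundle.Trivial M ℝ) hq hq (by simp)]
  have key : ∀ v : E, A q v = mvfderiv I φ q ((trivializationAt E (TangentSpace I) p).symm q v) := by
    intro v
    change ContinuousLinearMap.inCoordinates E (TangentSpace I) F (TangentSpace 𝓘(ℝ, F))
      p q (φ p) (φ q) (mfderiv I 𝓘(ℝ, F) φ q) v = _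
    rw [ContinuousLinearMap.inCoordinates]
    rw [TangentBundle.continuousLinearMapAt_model_space]
    change mfderiv I 𝓘(ℝ, F) φ q
      (Trivialization.symmL ℝ (trivializationAt E (TangentSpace I) p) q v) = _
    rw [Trivialization.symmL_apply _ hq]
    rfl
  simp [pullbackInner_apply, key, B]
  rfl

end Pullback

lemma isVonNBounded_of_pos {V : Type*} [NormedAddCommGroup V] [NormedSpace ℝ V]
    [FiniteDimensional ℝ V] (B : V →L[ℝ] V →L[ℝ] ℝ) (hB : ∀ v, v ≠ 0 → 0 < B v v) :
    Bornology.IsVonNBounded ℝ {v : V | B v v < 1} := by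
  have : ProperSpace V := FiniteDimensional.proper ℝ V
  obtain ⟨c, hc, h⟩ : ∃ c > 0, ∀ v : V, c * ‖v‖ ^ 2 ≤ B v v := by
    rcases (Metric.sphere (0 : V) 1).eq_empty_or_nonempty with h | h
    · refine ⟨1, one_pos, fun v => ?_⟩
      have hv : v = 0 := by
        by_contra hv
        have : (‖v‖⁻¹ • v) ∈ Metric.sphere (0 : V) 1 := by
          simp [norm_smul, inv_mul_cancel₀ (norm_ne_zero_iff.2 hv)]
        simp [h] at this
      simp [hv]
    · obtain ⟨v₀, hv₀, hmin⟩ := (isCompact_sphere (0 : V) 1).exists_isMinOn h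
        (f := fun v => B v v)
        (B.continuous.clm_apply continuous_id).continuousOn
      have hv₀' : v₀ ≠ 0 := by
        rintro rfl
        simp at hv₀
      refine ⟨B v₀ v₀, hB _ hv₀', fun v => ?_⟩
      rcases eq_or_ne v 0 with rfl | hv
      · simp
      have h1 : (‖v‖⁻¹ • v) ∈ Metric.sphere (0 : V) 1 := by
        simp [norm_smul, inv_mul_cancel₀ (norm_ne_zero_iff.2 hv)]
      have h2 : B v₀ v₀ ≤ B (‖v‖⁻¹ • v) (‖v‖⁻¹ • v) := hmin h1
      have hpos : 0 < ‖v‖ := norm_pos_iff.2 hv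
      simp only [map_smul, _root_.smul_apply, smul_eq_mul] at h2
      calc B v₀ v₀ * ‖v‖ ^ 2 ≤ (‖v‖⁻¹ * (‖v‖⁻¹ * B v v)) * ‖v‖ ^ 2 := by gcongr
        _ = B v v := by field_simp
  refine NormedSpace.isVonNBounded_of_isBounded ℝ ?_
  refine (Metric.isBounded_closedBall (x := (0 : V)) (r := √(1 / c))).subset fun v hv => ?_
  replace hv : B v v < 1 := hv
  rw [mem_closedBall_zero_iff]
  refine Real.le_sqrt_of_sq_le ?_
  rw [le_div_iff₀ hc]
  nlinarith [h v]

/-- The unit sphere `𝕊ⁿ` of `ℝⁿ⁺¹`. -/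
abbrev UnitSphere (n : ℕ) : Type := Metric.sphere (0 : EuclideanSpace ℝ (Fin (n + 1))) 1

/-- A warping function on the open set `J` of real numbers (usually an open interval): a function
that is smooth and positive on `J`. Its values outside of `J` are irrelevant. -/
structure WarpingFunction (J : TopologicalSpace.Opens ℝ) where
  /-- The underlying function. -/
  toFun : ℝ → ℝ
  contDiffOn : ContDiffOn ℝ ∞ toFun J
  pos : ∀ t ∈ J, 0 < toFun t

/-- The manifold `J × 𝕊ⁿ` that carries the warped product metric `dt² + f(t)² dσ²`; the metric is
`WarpedProduct.metric` below. -/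
def WarpedProduct (n : ℕ) {J : TopologicalSpace.Opens ℝ} (_f : WarpingFunction J) : Type :=
  J × UnitSphere n

/-- The model with corners of `I × 𝕊ⁿ`. -/
abbrev warpedModel (n : ℕ) : ModelWithCorners ℝ (ℝ × EuclideanSpace ℝ (Fin n))
    (ModelProd ℝ (EuclideanSpace ℝ (Fin n))) :=
  𝓘(ℝ, ℝ).prod (𝓡 n)

namespace WarpedProduct

variable {n : ℕ} {J : TopologicalSpace.Opens ℝ} (f : WarpingFunction J)

instance : TopologicalSpace (WarpedProduct n f) :=
  inferInstanceAs (TopologicalSpace (J × UnitSphere n))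

instance : ChartedSpace (ModelProd ℝ (EuclideanSpace ℝ (Fin n))) (WarpedProduct n f) :=
  inferInstanceAs (ChartedSpace (ModelProd ℝ (EuclideanSpace ℝ (Fin n))) (J × UnitSphere n))

instance : IsManifold (warpedModel n) ∞ (WarpedProduct n f) :=
  inferInstanceAs (IsManifold (𝓘(ℝ, ℝ).prod (𝓡 n)) ∞ (J × UnitSphere n))

variable {f}

/-- The coordinate `t : J × 𝕊ⁿ → ℝ`. -/
def height (p : WarpedProduct n f) : ℝ := (p.1 : ℝ)

/-- The projection `J × 𝕊ⁿ → 𝕊ⁿ ⊂ ℝⁿ⁺¹`. -/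
def direction (p : WarpedProduct n f) : EuclideanSpace ℝ (Fin (n + 1)) := (p.2 : _)

lemma contMDiff_height : ContMDiff (warpedModel n) 𝓘(ℝ, ℝ) ∞ (height (n := n) (f := f)) :=
  (contMDiff_subtype_val (I := 𝓘(ℝ, ℝ)) (U := J)).comp
    (contMDiff_fst (I := 𝓘(ℝ, ℝ)) (J := 𝓡 n) (M := J) (N := UnitSphere n))

lemma contMDiff_direction :
    ContMDiff (warpedModel n) 𝓘(ℝ, EuclideanSpace ℝ (Fin (n + 1))) ∞
      (direction (n := n) (f := f)) :=
  have : Fact (Module.finrank ℝ (EuclideanSpace ℝ (Fin (n + 1))) = n + 1) := ⟨by simp⟩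
  (contMDiff_coe_sphere (n := n) (E := EuclideanSpace ℝ (Fin (n + 1)))).comp
    (contMDiff_snd (I := 𝓘(ℝ, ℝ)) (J := 𝓡 n) (M := J) (N := UnitSphere n))

/-- The inner product `dt² + f(t)² dσ²`, where the standard metric `dσ²` of `𝕊ⁿ` is induced by the
inclusion in `ℝⁿ⁺¹`. -/
def warpedInner (p : WarpedProduct n f) : TangentSpace (warpedModel n) p →L[ℝ]
    TangentSpace (warpedModel n) p →L[ℝ] ℝ :=
  pullbackInner (warpedModel n) height p +
    f.toFun p.height ^ 2 • pullbackInner (warpedModel n) direction p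

lemma warpedInner_apply (p : WarpedProduct n f) (u v : TangentSpace (warpedModel n) p) :
    warpedInner p u v = mvfderiv (warpedModel n) height p u * mvfderiv (warpedModel n) height p v +
      f.toFun p.height ^ 2 * inner ℝ (mvfderiv (warpedModel n) direction p u)
        (mvfderiv (warpedModel n) direction p v) := by
  change inner ℝ (mvfderiv (warpedModel n) height p u)
    (mvfderiv (warpedModel n) height p v) + _ = _
  rw [real_inner_comm]
  rfl

lemma mvfderiv_subtype_val (t : J) (a : ℝ) :
    mvfderiv 𝓘(ℝ, ℝ) (fun s : J => (s : ℝ)) t a = a := by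
  have h : HasMFDerivAt 𝓘(ℝ, ℝ) 𝓘(ℝ, ℝ) (fun s : J => (s : ℝ)) t
      (ContinuousLinearMap.id ℝ ℝ) := by
    refine ⟨continuous_subtype_val.continuousAt, ?_⟩
    refine ((hasFDerivAt_id _).congr_of_eventuallyEq ?_).hasFDerivWithinAt
    have := TopologicalSpace.Opens.chartAt_subtype_val_symm_eventuallyEq (H := ℝ) J (x := t)
    filter_upwards [this] with y hy
    exact hy.symm
  have h2 := h.mfderiv
  exact congrArg (fun L : ℝ →L[ℝ] ℝ => L a) h2

lemma mvfderiv_height_aux (p : J × UnitSphere n) (u : ℝ × EuclideanSpace ℝ (Fin n)) :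
    mvfderiv (𝓘(ℝ, ℝ).prod (𝓡 n)) (fun q : J × UnitSphere n => (q.1 : ℝ)) p u = u.1 := by
  have h1 : MDifferentiableAt 𝓘(ℝ, ℝ) 𝓘(ℝ, ℝ) (fun s : J => (s : ℝ)) p.1 :=
    contMDiff_subtype_val.mdifferentiableAt one_ne_zero
  have h := mvfderiv_comp_apply (I' := 𝓘(ℝ, ℝ).prod (𝓡 n)) (M' := J × UnitSphere n) (f := Prod.fst) p h1 mdifferentiableAt_fst u
  rw [mfderiv_fst] at h
  exact h.trans (mvfderiv_subtype_val _ _)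

lemma mvfderiv_height (p : WarpedProduct n f) (u : TangentSpace (warpedModel n) p) :
    mvfderiv (warpedModel n) height p u = (show ℝ × EuclideanSpace ℝ (Fin n) from u).1 :=
  mvfderiv_height_aux p u

lemma mvfderiv_direction_aux (p : J × UnitSphere n) (u : ℝ × EuclideanSpace ℝ (Fin n)) :
    mvfderiv (𝓘(ℝ, ℝ).prod (𝓡 n))
        (fun q : J × UnitSphere n => (q.2 : EuclideanSpace ℝ (Fin (n + 1)))) p u =
      mvfderiv (𝓡 n) (fun q : UnitSphere n => (q : EuclideanSpace ℝ (Fin (n + 1)))) p.2 u.2 := by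
  have : Fact (Module.finrank ℝ (EuclideanSpace ℝ (Fin (n + 1))) = n + 1) := ⟨by simp⟩
  have h1 : MDifferentiableAt (𝓡 n) 𝓘(ℝ, EuclideanSpace ℝ (Fin (n + 1)))
      (fun q : UnitSphere n => (q : EuclideanSpace ℝ (Fin (n + 1)))) p.2 :=
    contMDiff_coe_sphere.mdifferentiableAt one_ne_zero
  have h := mfderiv_comp_apply (I := 𝓘(ℝ, ℝ).prod (𝓡 n)) (M := J × UnitSphere n)
    (f := Prod.snd) p h1 mdifferentiableAt_snd u
  rw [mfderiv_snd] at h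
  exact h

lemma mvfderiv_direction (p : WarpedProduct n f) (u : TangentSpace (warpedModel n) p) :
    mvfderiv (warpedModel n) direction p u =
      mvfderiv (𝓡 n) (fun q : UnitSphere n => (q : EuclideanSpace ℝ (Fin (n + 1)))) p.2
        (show ℝ × EuclideanSpace ℝ (Fin n) from u).2 :=
  mvfderiv_direction_aux p u

lemma warpedInner_pos (p : WarpedProduct n f) (u : TangentSpace (warpedModel n) p) (hu : u ≠ 0) :
    0 < warpedInner p u u := by
  have : Fact (Module.finrank ℝ (EuclideanSpace ℝ (Fin (n + 1))) = n + 1) := ⟨by simp⟩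
  have hf : 0 < f.toFun p.height := f.pos _ p.1.2
  rw [warpedInner_apply, real_inner_self_eq_norm_sq]
  by_contra! h
  have h1 : mvfderiv (warpedModel n) height p u = 0 := by
    nlinarith [mul_self_nonneg (mvfderiv (warpedModel n) height p u),
      sq_nonneg (f.toFun p.height * ‖mvfderiv (warpedModel n) direction p u‖)]
  have h2 : ‖mvfderiv (warpedModel n) direction p u‖ = 0 := by
    rw [h1] at h
    have : ‖mvfderiv (warpedModel n) direction p u‖ ^ 2 ≤ 0 := by
      by_contra! h3
      have := mul_pos (pow_pos hf 2) h3
      linarith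
    exact pow_eq_zero_iff two_ne_zero |>.1 (le_antisymm this (sq_nonneg _))
  rw [norm_eq_zero, mvfderiv_direction] at h2
  rw [mvfderiv_height] at h1
  have h3 := (injective_iff_map_eq_zero _).1 (injective_mvfderiv_subtypeVal_sphere p.2) _ h2
  exact hu (Prod.ext h1 h3)

variable (n f) in
/-- The warped product metric `dt² + f(t)² dσ²` on `I × 𝕊ⁿ`, as a smooth Riemannian metric. -/
def metric : ContMDiffRiemannianMetric (warpedModel n) ∞ (ℝ × EuclideanSpace ℝ (Fin n))
    (fun p : WarpedProduct n f => TangentSpace (warpedModel n) p) where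
  inner := warpedInner
  symm p u v := by
    rw [warpedInner_apply, warpedInner_apply, mul_comm, real_inner_comm]
  pos := warpedInner_pos
  isVonNBounded p := isVonNBounded_of_pos (V := ℝ × EuclideanSpace ℝ (Fin n)) (warpedInner p)
    (warpedInner_pos p)
  contMDiff := by
    have hf : ContMDiff (warpedModel n) 𝓘(ℝ, ℝ) ∞
        (fun p : WarpedProduct n f => f.toFun p.height ^ 2) :=
      (f.contDiffOn.pow 2).contMDiffOn.comp_contMDiff contMDiff_height fun p => p.1.2
    exact (contMDiff_pullbackInner contMDiff_height).add_section
      (hf.smul_section (contMDiff_pullbackInner contMDiff_direction))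

instance : RiemannianBundle (fun p : WarpedProduct n f => TangentSpace (warpedModel n) p) :=
  ⟨(metric n f).toRiemannianMetric⟩

/-- The unit vector field `∂_t` on `I × 𝕊ⁿ`. -/
def partialT (p : WarpedProduct n f) : TangentSpace (warpedModel n) p :=
  ((1, 0) : ℝ × EuclideanSpace ℝ (Fin n))

lemma mvfderiv_height_partialT (p : WarpedProduct n f) :
    mvfderiv (warpedModel n) height p (partialT p) = 1 :=
  mvfderiv_height p _

lemma mvfderiv_direction_partialT (p : WarpedProduct n f) :
    mvfderiv (warpedModel n) direction p (partialT p) = 0 := by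
  rw [mvfderiv_direction]
  exact map_zero _

end WarpedProduct

section Immersion

variable {E : Type*} [NormedAddCommGroup E] [NormedSpace ℝ E] [FiniteDimensional ℝ E]
  {H : Type*} [TopologicalSpace H] (I : ModelWithCorners ℝ E H)
  {M : Type*} [TopologicalSpace M] [ChartedSpace H M]
  [RiemannianBundle (fun p : M => TangentSpace I p)]
  {E' : Type*} [NormedAddCommGroup E'] [NormedSpace ℝ E'] [FiniteDimensional ℝ E']
  {H' : Type*} [TopologicalSpace H'] (I' : ModelWithCorners ℝ E' H')
  {N : Type*} [TopologicalSpace N] [ChartedSpace H' N]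
  [RiemannianBundle (fun p : N => TangentSpace I' p)]

/-- A smooth map between Riemannian manifolds is an isometric immersion if its differential
preserves the inner products of tangent vectors (so that the differential is injective). -/
structure IsIsometricImmersion (x : M → N) : Prop where
  contMDiff : ContMDiff I I' ∞ x
  inner_mfderiv : ∀ (p : M) (u v : TangentSpace I p),
    inner ℝ (mfderiv I I' x p u) (mfderiv I I' x p v) = inner ℝ u v

/-- The tangent component of a vector of the ambient space at `x p`, as a tangent vector of `M`:
it is the vector `τ` with `⟨τ, u⟩ = ⟨V, dx(u)⟩` for all `u`. -/
def tangentPart (x : M → N) (p : M) (V : TangentSpace I' (x p)) : TangentSpace I p :=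
  (mfderiv I I' x p).adjoint V

/-- The normal component of a vector of the ambient space at `x p`. -/
def normalPart (x : M → N) (p : M) (V : TangentSpace I' (x p)) : TangentSpace I' (x p) :=
  V - mfderiv I I' x p (tangentPart I I' x p V)

/-- A vector of the ambient space at `x p` is normal to the immersion. -/
def IsNormalAt (x : M → N) (p : M) (ξ : TangentSpace I' (x p)) : Prop :=
  ∀ a : TangentSpace I p, inner ℝ ξ (mfderiv I I' x p a) = 0

/-- The curvature of a connection `D`, where `D σ p u` stands for `D_u σ`:
`R(u, v)σ = D_u D_v σ - D_v D_u σ - D_[u, v] σ`. -/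
def curvature {W : M → Type*} [∀ p, AddCommGroup (W p)]
    (D : (Π p : M, W p) → Π p : M, TangentSpace I p → W p)
    (u v : Π p : M, TangentSpace I p) (σ : Π p : M, W p) (p : M) : W p :=
  D (fun q => D σ q (v q)) p (u p) - D (fun q => D σ q (u q)) p (v p)
    - D σ p (VectorField.mlieBracket I u v p)

variable [IsManifold I ∞ M] [IsContMDiffRiemannianBundle I ∞ E (fun p : M => TangentSpace I p)]
  [IsManifold I' ∞ N] [IsContMDiffRiemannianBundle I' ∞ E' (fun p : N => TangentSpace I' p)]

/-- The Riemannian curvature `R(u, v)w` of `M`. -/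
def riemannCurvature (u v w : Π p : M, TangentSpace I p) (p : M) : TangentSpace I p :=
  curvature I (fun σ q a => leviCivita I M σ q a) u v w p

/-- The covariant derivative `∇̄_u V` of a field `V` along `x`, for the Levi-Civita connection of the
ambient space. In a local frame `E_i` of the ambient tangent bundle around `x p` (the one of
the standard trivialization), if `V = ∑ Vⁱ (E_i ∘ x)`, then
`∇̄_u V = ∑ dVⁱ(u) E_i + ∇̄_{dx(u)} (∑ Vⁱ(p) E_i)`. -/
def alongDeriv (x : M → N) (V : Π p : M, TangentSpace I' (x p)) (p : M)
    (u : TangentSpace I p) : TangentSpace I' (x p) :=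
  (trivializationAt E' (TangentSpace I' : N → Type _) (x p)).symm (x p)
      (mfderiv I 𝓘(ℝ, E') (fun q => (trivializationAt E' (TangentSpace I' : N → Type _) (x p)
        (⟨x q, V q⟩ : TangentBundle I' N)).2) p u)
    + leviCivita I' N (extend E' (V p)) (x p) (mfderiv I I' x p u)

/-- The second fundamental form `α(u, v)`, the normal part of `∇̄_u dx(v)`, where the tangent
vector `v` is extended to a smooth local vector field. -/
def secondFundamentalForm (x : M → N) (p : M) (u v : TangentSpace I p) : TangentSpace I' (x p) :=
  normalPart I I' x p
    (alongDeriv I I' x (fun q => mfderiv I I' x q (extend E v q)) p u)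

/-- The normal connection `∇^⊥_u ξ`, the normal part of `∇̄_u ξ`. -/
def normalConnection (x : M → N) (ξ : Π p : M, TangentSpace I' (x p)) (p : M)
    (u : TangentSpace I p) : TangentSpace I' (x p) :=
  normalPart I I' x p (alongDeriv I I' x ξ p u)

/-- The curvature `R^⊥(u, v)ξ` of the normal connection. -/
def normalCurvature (x : M → N) (u v : Π p : M, TangentSpace I p)
    (ξ : Π p : M, TangentSpace I' (x p)) (p : M) : TangentSpace I' (x p) :=
  curvature I (W := fun q : M => TangentSpace I' (x q)) (normalConnection I I' x) u v ξ p

/-- The covariant derivative of the second fundamental form,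
`(∇^⊥_u α)(v, w) = ∇^⊥_u (α(v, w)) - α(∇_u v, w) - α(v, ∇_u w)`. -/
def covSecondFundamentalForm (x : M → N) (u v w : Π p : M, TangentSpace I p) (p : M) :
    TangentSpace I' (x p) :=
  normalConnection I I' x (fun q => secondFundamentalForm I I' x q (v q) (w q)) p (u p)
    - secondFundamentalForm I I' x p (leviCivita I M v p (u p)) (w p)
    - secondFundamentalForm I I' x p (v p) (leviCivita I M w p (u p))

/-- The Weingarten endomorphism `A_ξ` of the tangent space at `p`, that is, the vector `A_ξ u` with
`⟨A_ξ u, v⟩ = ⟨α(u, v), ξ⟩` for all `v`, written in an orthonormal basis. -/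
def weingarten (x : M → N) (p : M) (ξ : TangentSpace I' (x p)) (u : TangentSpace I p) :
    TangentSpace I p :=
  ∑ i, (inner ℝ (secondFundamentalForm I I' x p u (stdOrthonormalBasis ℝ (TangentSpace I p) i)) ξ
    : ℝ) • stdOrthonormalBasis ℝ (TangentSpace I p) i

end Immersion

/-- `(a, b, c, d) = ⟨⟨b, c⟩ a - ⟨a, c⟩ b, d⟩`. -/
def bracket4 {V : Type*} [NormedAddCommGroup V] [InnerProductSpace ℝ V] (a b c d : V) : ℝ :=
  inner ℝ ((inner ℝ b c : ℝ) • a - (inner ℝ a c : ℝ) • b) d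

namespace WarpingFunction

variable {J : TopologicalSpace.Opens ℝ} (f : WarpingFunction J)

/-- `λ(t) = (1 - f'(t)²) / f(t)²`. -/
def lam (t : ℝ) : ℝ := (1 - deriv f.toFun t ^ 2) / f.toFun t ^ 2

/-- `μ(t) = (1 - f'(t)²) / f(t)² + f''(t) / f(t)`. -/
def mu (t : ℝ) : ℝ :=
  (1 - deriv f.toFun t ^ 2) / f.toFun t ^ 2 + deriv (deriv f.toFun) t / f.toFun t

end WarpingFunction

end SubmanifoldGeometry

end

open SubmanifoldGeometry

noncomputable section

namespace SubmanifoldGeometry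

section CoordinateForm

variable {E : Type*} [NormedAddCommGroup E] [NormedSpace ℝ E]
  {H : Type*} [TopologicalSpace H] {I : ModelWithCorners ℝ E H}
  {M : Type*} [TopologicalSpace M] [ChartedSpace H M] [IsManifold I ∞ M]
  {E' : Type*} [NormedAddCommGroup E'] [NormedSpace ℝ E']
  {H' : Type*} [TopologicalSpace H'] {I' : ModelWithCorners ℝ E' H'}
  {N : Type*} [TopologicalSpace N] [ChartedSpace H' N] [IsManifold I' ∞ N]
  {F : Type*} [NormedAddCommGroup F] [NormedSpace ℝ F]

/-- A vector-valued one-form on `N`, read in the standard trivialization of `TN` around `y₀`. -/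
def coordForm (Φ : Π y : N, TangentSpace I' y →L[ℝ] F) (y₀ y : N) : E' →L[ℝ] F :=
  (Φ y).comp ((trivializationAt E' (TangentSpace I' : N → Type _) y₀).symmL ℝ y)

/-- A vector-valued one-form is of class `C^m` at `y₀`. -/
def SmoothFormAt (m : ℕ∞ω) (Φ : Π y : N, TangentSpace I' y →L[ℝ] F) (y₀ : N) : Prop :=
  ContMDiffAt I' 𝓘(ℝ, E' →L[ℝ] F) m (coordForm Φ y₀) y₀

lemma coordForm_apply_trivialization (Φ : Π y : N, TangentSpace I' y →L[ℝ] F) {y₀ y : N}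
    (hy : y ∈ (trivializationAt E' (TangentSpace I' : N → Type _) y₀).baseSet)
    (v : TangentSpace I' y) :
    coordForm Φ y₀ y (trivializationAt E' (TangentSpace I' : N → Type _) y₀ ⟨y, v⟩).2 = Φ y v := by
  simp only [coordForm, ContinuousLinearMap.comp_apply]
  rw [Trivialization.symmL_apply _ hy, Trivialization.symm_apply_apply_mk _ hy]

lemma smoothFormAt_mvfderiv {n m : ℕ∞ω} {g : N → F} {y₀ : N} (hg : ContMDiffAt I' 𝓘(ℝ, F) n g y₀)
    (hmn : m + 1 ≤ n) : SmoothFormAt (I' := I') m (mvfderiv I' g) y₀ := by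
  have hA := hg.mfderiv_const (m := m) hmn
  refine hA.congr_of_eventuallyEq ?_
  filter_upwards [(trivializationAt E' (TangentSpace I') y₀).open_baseSet.mem_nhds
    (mem_baseSet_trivializationAt E' (TangentSpace I') y₀)] with q hq
  ext v
  change _ = ContinuousLinearMap.inCoordinates E' (TangentSpace I') F (TangentSpace 𝓘(ℝ, F))
      y₀ q (g y₀) (g q) (mfderiv I' 𝓘(ℝ, F) g q) v
  rw [ContinuousLinearMap.inCoordinates, TangentBundle.continuousLinearMapAt_model_space]
  rfl

lemma SmoothFormAt.add {m : ℕ∞ω} {Φ Ψ : Π y : N, TangentSpace I' y →L[ℝ] F} {y₀ : N}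
    (hΦ : SmoothFormAt m Φ y₀) (hΨ : SmoothFormAt m Ψ y₀) :
    SmoothFormAt m (fun y => Φ y + Ψ y) y₀ :=
  (ContMDiffAt.add hΦ hΨ).congr_of_eventuallyEq (Filter.Eventually.of_forall fun _ => rfl)

lemma SmoothFormAt.smul {m : ℕ∞ω} {Φ : Π y : N, TangentSpace I' y →L[ℝ] F} {g : N → ℝ} {y₀ : N}
    (hg : ContMDiffAt I' 𝓘(ℝ, ℝ) m g y₀) (hΦ : SmoothFormAt m Φ y₀) :
    SmoothFormAt m (fun y => g y • Φ y) y₀ :=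
  (ContMDiffAt.smul hg hΦ).congr_of_eventuallyEq (Filter.Eventually.of_forall fun _ => rfl)

lemma SmoothFormAt.smulRight {m : ℕ∞ω} {Φ : Π y : N, TangentSpace I' y →L[ℝ] ℝ} {y₀ : N}
    (hΦ : SmoothFormAt m Φ y₀) (e : F) :
    SmoothFormAt m (fun y => (Φ y).smulRight e) y₀ := by
  let B : (E' →L[ℝ] ℝ) →L[ℝ] E' →L[ℝ] F :=
    ContinuousLinearMap.compL ℝ E' ℝ F ((ContinuousLinearMap.id ℝ ℝ).smulRight e)
  refine (B.contDiff.contMDiff.contMDiffAt.comp y₀ hΦ).congr_of_eventuallyEq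
    (Filter.Eventually.of_forall fun y => ?_)
  ext v
  simp [B, coordForm]

/-- Applying a one-form of class `C^m` to a `C^m` vector field along a map. -/
lemma SmoothFormAt.apply_along {m : ℕ∞ω} {Φ : Π y : N, TangentSpace I' y →L[ℝ] F} {x : M → N}
    {p : M} (hΦ : SmoothFormAt m Φ (x p)) {V : Π q : M, TangentSpace I' (x q)}
    (hV : ContMDiffAt I I'.tangent m (fun q => (⟨x q, V q⟩ : TangentBundle I' N)) p) :
    ContMDiffAt I 𝓘(ℝ, F) m (fun q => Φ (x q) (V q)) p := by
  rw [contMDiffAt_totalSpace] at hV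
  have h1 : ContMDiffAt I 𝓘(ℝ, E' →L[ℝ] F) m (fun q => coordForm Φ (x p) (x q)) p :=
    ContMDiffAt.comp p hΦ hV.1
  refine (h1.clm_apply hV.2).congr_of_eventuallyEq ?_
  filter_upwards [hV.1.continuousAt.preimage_mem_nhds
    ((trivializationAt E' (TangentSpace I') (x p)).open_baseSet.mem_nhds
    (mem_baseSet_trivializationAt E' (TangentSpace I') (x p)))] with q hq
  exact (coordForm_apply_trivialization Φ hq (V q)).symm

lemma contMDiffAt_mvfderiv_apply {n m : ℕ∞ω} {g : M → F} {p : M}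
    (hg : ContMDiffAt I 𝓘(ℝ, F) n g p) (hmn : m + 1 ≤ n) {u : Π q : M, TangentSpace I q}
    (hu : ContMDiffAt I I.tangent m (fun q => (⟨q, u q⟩ : TangentBundle I M)) p) :
    ContMDiffAt I 𝓘(ℝ, F) m (fun q => mvfderiv I g q (u q)) p :=
  (smoothFormAt_mvfderiv hg hmn).apply_along (x := id) hu

lemma mvfderiv_congr {g g' : M → F} {p : M} (h : g =ᶠ[𝓝 p] g') :
    mvfderiv I g p = mvfderiv I g' p := by
  ext v
  have := h.mfderiv_eq (I := I) (I' := 𝓘(ℝ, F))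
  exact congrArg (fun L : E →L[ℝ] F => L v) this

end CoordinateForm

section Bracket

variable {E : Type*} [NormedAddCommGroup E] [NormedSpace ℝ E] [CompleteSpace E]
  {H : Type*} [TopologicalSpace H] {I : ModelWithCorners ℝ E H}
  {M : Type*} [TopologicalSpace M] [ChartedSpace H M] [IsManifold I ∞ M]
  {F : Type*} [NormedAddCommGroup F] [NormedSpace ℝ F]

lemma mvfderiv_extChartAt_symm {r : M → F} {p : M} {y : E} (hy : y ∈ (extChartAt I p).target)
    (hr : MDifferentiableAt I 𝓘(ℝ, F) r ((extChartAt I p).symm y)) (w : E) :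
    mvfderiv I r ((extChartAt I p).symm y)
        (mfderivWithin 𝓘(ℝ, E) I (extChartAt I p).symm (Set.range I) y w) =
      fderivWithin ℝ (r ∘ (extChartAt I p).symm) (Set.range I) y w := by
  have hu : UniqueMDiffWithinAt 𝓘(ℝ, E) (Set.range I) y :=
    I.uniqueMDiffOn y (extChartAt_target_subset_range p hy)
  have h := mfderiv_comp_mfderivWithin (I := 𝓘(ℝ, E)) (I' := I) (I'' := 𝓘(ℝ, F)) y hr
    (mdifferentiableWithinAt_extChartAt_symm hy) hu
  rw [mfderivWithin_eq_fderivWithin] at h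
  exact (congrArg (fun L : E →L[ℝ] F => L w) h).symm

lemma mvfderiv_eq_fderivWithin_mpullbackWithin {r : M → F} {p : M} {y : E}
    (hy : y ∈ (extChartAt I p).target)
    (hr : MDifferentiableAt I 𝓘(ℝ, F) r ((extChartAt I p).symm y))
    (v : Π q : M, TangentSpace I q) :
    mvfderiv I r ((extChartAt I p).symm y) (v ((extChartAt I p).symm y)) =
      fderivWithin ℝ (r ∘ (extChartAt I p).symm) (Set.range I) y
        (VectorField.mpullbackWithin 𝓘(ℝ, E) I (extChartAt I p).symm v (Set.range I) y) := by
  refine Eq.trans ?_ (mvfderiv_extChartAt_symm hy hr _)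
  rw [VectorField.mpullbackWithin_apply]
  exact (congrArg _ ((isInvertible_mfderivWithin_extChartAt_symm hy).self_apply_inverse _)).symm

lemma mdifferentiableAt_mvfderiv_apply {g : M → F} {p : M} (hg : ContMDiffAt I 𝓘(ℝ, F) 2 g p)
    {v : Π q : M, TangentSpace I q} (hv : MDiffAt (T% v) p) :
    MDifferentiableAt I 𝓘(ℝ, F) (fun q => mvfderiv I g q (v q)) p := by
  have h1 := (smoothFormAt_mvfderiv hg (m := 1) (by norm_num)).mdifferentiableAt one_ne_zero
  rw [mdifferentiableAt_totalSpace] at hv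
  refine (h1.clm_apply hv.2).congr_of_eventuallyEq ?_
  filter_upwards [(trivializationAt E (TangentSpace I) p).open_baseSet.mem_nhds
    (mem_baseSet_trivializationAt E (TangentSpace I) p)] with q hq
  exact (coordForm_apply_trivialization (mvfderiv I g) hq (v q)).symm

/-- The Lie bracket of vector fields is the commutator of the derivations that they define. -/
theorem mvfderiv_mlieBracket {g : M → F} {p : M} (hg : ContMDiffAt I 𝓘(ℝ, F) 2 g p)
    {u v : Π q : M, TangentSpace I q} (hu : MDiffAt (T% u) p) (hv : MDiffAt (T% v) p) :
    mvfderiv I g p (VectorField.mlieBracket I u v p) =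
      mvfderiv I (fun q => mvfderiv I g q (v q)) p (u p) -
        mvfderiv I (fun q => mvfderiv I g q (u q)) p (v p) := by
  have hy := mem_extChartAt_target (I := I) p
  have hsymm := extChartAt_to_inv (I := I) p
  have hgd : ∀ᶠ q in 𝓝 p, MDifferentiableAt I 𝓘(ℝ, F) g q := by
    filter_upwards [(contMDiffAt_iff_contMDiffAt_nhds (by simp)).1 hg] with q hq
    exact hq.mdifferentiableAt two_ne_zero
  set φ := extChartAt I p with hφ
  let S := Set.range I
  let ĝ : E → F := g ∘ φ.symm
  have hmem : φ p ∈ S := Set.mem_range_self _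
  have hS : UniqueDiffWithinAt ℝ S (φ p) := I.uniqueDiffOn _ hmem
  have hĝ : ContDiffWithinAt ℝ 2 ĝ S (φ p) := by
    simpa using! (contMDiffAt_iff.1 hg).2
  have hdĝ : DifferentiableWithinAt ℝ (fderivWithin ℝ ĝ S) S (φ p) :=
    (hĝ.fderivWithin_right (m := 1) I.uniqueDiffOn (by norm_num) hmem).differentiableWithinAt
      one_ne_zero
  have hsym : IsSymmSndFDerivWithinAt ℝ ĝ S (φ p) :=
    hĝ.isSymmSndFDerivWithinAt (by simp) I.uniqueDiffOn
      (I.range_subset_closure_interior hmem) hmem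
  obtain ⟨pull, hpull⟩ : ∃ pull : (Π q : M, TangentSpace I q) → E → E, ∀ w y,
      pull w y = VectorField.mpullbackWithin 𝓘(ℝ, E) I φ.symm w S y := ⟨_, fun _ _ => rfl⟩
  have hpulld : ∀ {w : Π q : M, TangentSpace I q}, MDiffAt (T% w) p →
      DifferentiableWithinAt ℝ (pull w) S (φ p) := by
    intro w hw
    have := (mdifferentiableWithinAt_univ.2 hw).differentiableWithinAt_mpullbackWithin_vectorField
    rw [Set.preimage_univ, Set.univ_inter] at this
    exact this.congr (fun y _ => hpull w y) (hpull w _)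
  have happly : ∀ {r : M → F} {y : E} (_ : y ∈ φ.target)
      (_ : MDifferentiableAt I 𝓘(ℝ, F) r (φ.symm y)) (w : Π q : M, TangentSpace I q),
      mvfderiv I r (φ.symm y) (w (φ.symm y)) = fderivWithin ℝ (r ∘ φ.symm) S y (pull w y) := by
    intro r y hy hr w
    rw [hpull]
    exact mvfderiv_eq_fderivWithin_mpullbackWithin hy hr w
  have key : ∀ {w z : Π q : M, TangentSpace I q}, MDiffAt (T% w) p →
      mvfderiv I (fun q => mvfderiv I g q (w q)) p (z p) =
        fderivWithin ℝ ĝ S (φ p) (fderivWithin ℝ (pull w) S (φ p) (pull z (φ p))) +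
        fderivWithin ℝ (fderivWithin ℝ ĝ S) S (φ p) (pull z (φ p)) (pull w (φ p)) := by
    intro w z hw
    have h1 := happly (r := fun q => mvfderiv I g q (w q)) hy
      (by rw [hsymm]; exact mdifferentiableAt_mvfderiv_apply hg hw) z
    rw [hsymm] at h1
    rw [h1]
    have h2 : ((fun q => mvfderiv I g q (w q)) ∘ φ.symm) =ᶠ[𝓝[S] (φ p)]
        fun y => fderivWithin ℝ ĝ S y (pull w y) := by
      have h3 : Filter.Tendsto φ.symm (𝓝[S] (φ p)) (𝓝 p) := by
        have := (continuousAt_extChartAt_symm (I := I) p).tendsto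
        rw [extChartAt_to_inv] at this
        exact this.mono_left nhdsWithin_le_nhds
      filter_upwards [h3.eventually hgd, extChartAt_target_mem_nhdsWithin p] with y hy1 hy2
      exact happly hy2 hy1 w
    rw [h2.fderivWithin_eq_of_mem hmem, fderivWithin_clm_apply hS hdĝ (hpulld hw)]
    rfl
  have hbr : (VectorField.mlieBracket I u v p : E) =
      fderivWithin ℝ (pull v) S (φ p) (pull u (φ p)) -
        fderivWithin ℝ (pull u) S (φ p) (pull v (φ p)) := by
    have h1 := VectorField.mlieBracketWithin_apply (I := I) (V := u) (W := v) (s := Set.univ)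
      (x₀ := p)
    have h2 := congrArg (fun L : E →L[ℝ] E => L.inverse
      (fderivWithin ℝ (pull v) S (φ p) (pull u (φ p)) -
        fderivWithin ℝ (pull u) S (φ p) (pull v (φ p)))) (mfderiv_extChartAt_self (I := I) (x := p))
    rw [Set.preimage_univ, Set.univ_inter] at h1
    refine (Eq.trans h1 ?_).trans (h2.trans ?_)
    · have h3 : pull = fun w y => VectorField.mpullbackWithin 𝓘(ℝ, E) I φ.symm w S y := by
        funext w y
        exact hpull w y
      rw [h3]
      rfl
    · exact congrArg (fun L : E →L[ℝ] E => L _) (ContinuousLinearMap.inverse_id (R := ℝ) (M := E))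
  have hg' : mvfderiv I g p = fderivWithin ℝ ĝ S (φ p) := by
    ext w
    have h1 := mvfderiv_extChartAt_symm hy (r := g) (by rw [hsymm]; exact hgd.self_of_nhds) w
    have h2 : mfderivWithin 𝓘(ℝ, E) I φ.symm S (φ p) = ContinuousLinearMap.id ℝ _ :=
      mfderivWithin_range_extChartAt_symm
    have h3 : mvfderiv I g (φ.symm (φ p)) w = fderivWithin ℝ ĝ S (φ p) w :=
      (congrArg (fun L : E →L[ℝ] E => mvfderiv I g (φ.symm (φ p)) (L w)) h2).symm.trans h1
    rw [hsymm] at h3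
    exact h3
  rw [key hv, key hu, hg']
  refine (congrArg (fderivWithin ℝ ĝ S (φ p)) hbr).trans ?_
  rw [map_sub, hsym (pull u (φ p)) (pull v (φ p))]
  abel

end Bracket

section Gram

variable {E : Type*} [NormedAddCommGroup E] [NormedSpace ℝ E]
  {H : Type*} [TopologicalSpace H] {I : ModelWithCorners ℝ E H}
  {M : Type*} [TopologicalSpace M] [ChartedSpace H M] [IsManifold I ∞ M]
  {E' : Type*} [NormedAddCommGroup E'] [NormedSpace ℝ E'] [FiniteDimensional ℝ E']
  {H' : Type*} [TopologicalSpace H'] {I' : ModelWithCorners ℝ E' H'}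
  {N : Type*} [TopologicalSpace N] [ChartedSpace H' N] [IsManifold I' ∞ N]
  {F : Type*} [NormedAddCommGroup F] [InnerProductSpace ℝ F]

/-- The Gram form `(a, b) ↦ ⟨L a, L b⟩` of a linear map into an inner product space. -/
def gramForm (L : E' →L[ℝ] F) : E' →L[ℝ] E' →L[ℝ] ℝ :=
  (L.precomp ℝ).comp ((innerSL ℝ : F →L[ℝ] F →L[ℝ] ℝ).comp L)

lemma gramForm_apply (L : E' →L[ℝ] F) (a b : E') : gramForm L a b = inner ℝ (L a) (L b) := rfl

lemma isInvertible_gramForm {L : E' →L[ℝ] F} (hL : Function.Injective L) :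
    (gramForm L).IsInvertible := by
  have hinj : Function.Injective (gramForm L) := by
    rw [injective_iff_map_eq_zero]
    intro a ha
    have h : inner ℝ (L a) (L a) = 0 := by rw [← gramForm_apply, ha]; rfl
    rw [inner_self_eq_zero] at h
    exact (injective_iff_map_eq_zero L).1 hL a h
  have hd : Module.finrank ℝ E' = Module.finrank ℝ (E' →L[ℝ] ℝ) := by
    rw [← (LinearMap.toContinuousLinearMap (𝕜 := ℝ) (E := E') (F' := ℝ)).finrank_eq]
    exact (Subspace.dual_finrank_eq).symm
  have : FiniteDimensional ℝ (E' →L[ℝ] ℝ) :=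
    LinearEquiv.finiteDimensional (LinearMap.toContinuousLinearMap (𝕜 := ℝ) (E := E') (F' := ℝ))
  exact ⟨(LinearEquiv.ofInjectiveOfFinrankEq (gramForm L).toLinearMap hinj hd).toContinuousLinearEquiv, by
    ext; rfl⟩

/-- A field `V` along `x` is as regular as the function that determines it through a regular
family of injective maps `Φ` of the tangent spaces into an inner product space. -/
lemma SmoothFormAt.contMDiffAt_of_inner {m : ℕ∞ω} {Φ : Π y : N, TangentSpace I' y →L[ℝ] F}
    {x : M → N} {p : M} (hΦ : SmoothFormAt m Φ (x p)) (hinj : Function.Injective (Φ (x p)))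
    (hx : ContMDiffAt I I' m x p) {s : M → F} (hs : ContMDiffAt I 𝓘(ℝ, F) m s p)
    {V : Π q : M, TangentSpace I' (x q)}
    (hV : ∀ᶠ q in 𝓝 p, ∀ a : TangentSpace I' (x q),
      inner ℝ (Φ (x q) (V q)) (Φ (x q) a) = inner ℝ (s q) (Φ (x q) a)) :
    ContMDiffAt I I'.tangent m (fun q => (⟨x q, V q⟩ : TangentBundle I' N)) p := by
  have : CompleteSpace E' := FiniteDimensional.complete ℝ E'
  rw [contMDiffAt_totalSpace]
  refine ⟨hx, ?_⟩
  have hp := mem_baseSet_trivializationAt E' (TangentSpace I' : N → Type _) (x p)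
  have hL : ContMDiffAt I 𝓘(ℝ, E' →L[ℝ] F) m (fun q => coordForm Φ (x p) (x q)) p :=
    ContMDiffAt.comp p hΦ hx
  have hpre : ContMDiffAt I 𝓘(ℝ, (F →L[ℝ] ℝ) →L[ℝ] E' →L[ℝ] ℝ) m
      (fun q => ((coordForm Φ (x p) (x q)).precomp ℝ : (F →L[ℝ] ℝ) →L[ℝ] E' →L[ℝ] ℝ)) p :=
    ContMDiffAt.clm_precomp hL
  let B : F →L[ℝ] F →L[ℝ] ℝ := innerSL ℝ
  have hG : ContMDiffAt I 𝓘(ℝ, E' →L[ℝ] E' →L[ℝ] ℝ) m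
      (fun q => gramForm (coordForm Φ (x p) (x q))) p := by
    have h2 : ContMDiffAt I 𝓘(ℝ, E' →L[ℝ] F →L[ℝ] ℝ) m
        (fun q => B.comp (coordForm Φ (x p) (x q))) p :=
      contMDiffAt_const.clm_comp hL
    exact hpre.clm_comp h2
  have hl : ContMDiffAt I 𝓘(ℝ, E' →L[ℝ] ℝ) m
      (fun q => ((coordForm Φ (x p) (x q)).precomp ℝ : (F →L[ℝ] ℝ) →L[ℝ] E' →L[ℝ] ℝ)
        (B (s q))) p :=
    hpre.clm_apply (B.contDiff.contMDiff.contMDiffAt.comp p hs)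
  have hcinj : Function.Injective (coordForm Φ (x p) (x p)) := by
    refine hinj.comp fun a b hab => ?_
    have hab' : (trivializationAt E' (TangentSpace I' : N → Type _) (x p)).symmL ℝ (x p) a =
      (trivializationAt E' (TangentSpace I' : N → Type _) (x p)).symmL ℝ (x p) b := hab
    rw [Trivialization.symmL_apply _ hp, Trivialization.symmL_apply _ hp] at hab'
    have h := congrArg (fun w => (trivializationAt E' (TangentSpace I' : N → Type _) (x p)
      ⟨x p, w⟩).2) hab'
    simpa [Trivialization.apply_mk_symm _ hp] using h
  have hinv : ContMDiffAt I 𝓘(ℝ, (E' →L[ℝ] ℝ) →L[ℝ] E') m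
      (fun q => (gramForm (coordForm Φ (x p) (x q))).inverse) p :=
    ContMDiffAt.comp (I' := 𝓘(ℝ, E' →L[ℝ] E' →L[ℝ] ℝ)) p
      ((isInvertible_gramForm hcinj).contDiffAt_map_inverse (n := m)).contMDiffAt hG
  refine (hinv.clm_apply hl).congr_of_eventuallyEq ?_
  have hopen : ∀ᶠ q in 𝓝 p, (gramForm (coordForm Φ (x p) (x q))).IsInvertible := by
    obtain ⟨e, he⟩ := isInvertible_gramForm hcinj
    have := hG.continuousAt.preimage_mem_nhds (by rw [← he]; exact ContinuousLinearEquiv.nhds e)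
    filter_upwards [this] with q hq using hq
  filter_upwards [hV, hopen, hx.continuousAt.preimage_mem_nhds
    ((trivializationAt E' (TangentSpace I') (x p)).open_baseSet.mem_nhds hp)] with q hq hG' hb
  set c := (trivializationAt E' (TangentSpace I' : N → Type _) (x p) ⟨x q, V q⟩).2 with hc
  have h1 : gramForm (coordForm Φ (x p) (x q)) c =
      ((coordForm Φ (x p) (x q)).precomp ℝ : (F →L[ℝ] ℝ) →L[ℝ] E' →L[ℝ] ℝ) (B (s q)) := by
    ext a
    rw [gramForm_apply, coordForm_apply_trivialization Φ hb]
    exact hq _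
  rw [← h1]
  exact ((hG'.inverse_apply_eq).2 rfl).symm

end Gram

section VectorValued

variable {E : Type*} [NormedAddCommGroup E] [NormedSpace ℝ E]
  {H : Type*} [TopologicalSpace H] {I : ModelWithCorners ℝ E H}
  {M : Type*} [TopologicalSpace M] [ChartedSpace H M]
  {F : Type*} [NormedAddCommGroup F] [InnerProductSpace ℝ F]

lemma mdifferentiableAt_inner_map {s t : M → F} {p : M} (hs : MDifferentiableAt I 𝓘(ℝ, F) s p)
    (ht : MDifferentiableAt I 𝓘(ℝ, F) t p) :
    MDifferentiableAt I 𝓘(ℝ, ℝ) (fun q => inner ℝ (s q) (t q)) p := by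
  have h := hs.prodMk_space ht
  have hi : DifferentiableAt ℝ (fun z : F × F => inner ℝ z.1 z.2) (s p, t p) :=
    differentiableAt_fst.inner ℝ differentiableAt_snd
  exact hi.mdifferentiableAt.comp p h

lemma contMDiffAt_inner_map {m : ℕ∞ω} {s t : M → F} {p : M} (hs : ContMDiffAt I 𝓘(ℝ, F) m s p)
    (ht : ContMDiffAt I 𝓘(ℝ, F) m t p) :
    ContMDiffAt I 𝓘(ℝ, ℝ) m (fun q => inner ℝ (s q) (t q)) p := by
  have h := hs.prodMk_space ht
  have hi : ContDiffAt ℝ m (fun z : F × F => inner ℝ z.1 z.2) (s p, t p) :=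
    contDiffAt_fst.inner ℝ contDiffAt_snd
  exact hi.contMDiffAt.comp p h

lemma mvfderiv_inner_map {s t : M → F} {p : M} (hs : MDifferentiableAt I 𝓘(ℝ, F) s p)
    (ht : MDifferentiableAt I 𝓘(ℝ, F) t p) (u : TangentSpace I p) :
    mvfderiv I (fun q => inner ℝ (s q) (t q)) p u =
      inner ℝ (mvfderiv I s p u) (t p) + inner ℝ (s p) (mvfderiv I t p u) := by
  rw [(mdifferentiableAt_inner_map hs ht).mvfderiv, hs.mvfderiv, ht.mvfderiv]
  have hs' := hs.differentiableWithinAt_writtenInExtChartAt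
  have ht' := ht.differentiableWithinAt_writtenInExtChartAt
  have hx : UniqueDiffWithinAt ℝ (Set.range I) (extChartAt I p p) :=
    I.uniqueDiffOn _ (Set.mem_range_self _)
  have := congrArg (fun L : E →L[ℝ] ℝ => L u)
    ((hs'.hasFDerivWithinAt.inner ℝ ht'.hasFDerivWithinAt).fderivWithin hx)
  simp only [writtenInExtChartAt, extChartAt_model_space_eq_id, PartialEquiv.refl_coe,
    Function.comp_def, extChartAt_to_inv] at this ⊢
  rw [add_comm]
  exact this

lemma mvfderiv_smul_map {a : M → ℝ} {s : M → F} {p : M} (ha : MDifferentiableAt I 𝓘(ℝ, ℝ) a p)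
    (hs : MDifferentiableAt I 𝓘(ℝ, F) s p) (u : TangentSpace I p) :
    mvfderiv I (fun q => a q • s q) p u = mvfderiv I a p u • s p + a p • mvfderiv I s p u := by
  rw [mvfderiv_fun_smul ha hs]
  simp [add_comm]

end VectorValued

section WarpedMap

variable {E : Type*} [NormedAddCommGroup E] [NormedSpace ℝ E] [CompleteSpace E]
  {H : Type*} [TopologicalSpace H] {I : ModelWithCorners ℝ E H}
  {M : Type*} [TopologicalSpace M] [ChartedSpace H M] [IsManifold I ∞ M]
  {F : Type*} [NormedAddCommGroup F] [InnerProductSpace ℝ F]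
  {J : TopologicalSpace.Opens ℝ} {f : WarpingFunction J} {e : F} {h : M → ℝ} {Θ : M → F}

variable (I J e h Θ) in
/-- A smooth map `(h, Θ)` into `J × 𝕊`, where `𝕊` is the unit sphere of the orthogonal complement of
the unit vector `e`. -/
structure IsWarpedMap : Prop where
  height : ContMDiff I 𝓘(ℝ, ℝ) ∞ h
  mem : ∀ q, h q ∈ J
  sphere : ContMDiff I 𝓘(ℝ, F) ∞ Θ
  inner_axis : inner ℝ e e = 1
  inner_axis_sphere : ∀ q, inner ℝ e (Θ q) = 0
  inner_sphere : ∀ q, inner ℝ (Θ q) (Θ q) = 1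

variable (I f e h Θ) in
/-- The differential `u ↦ dh(u) e + f(h) dΘ(u)` of a map into the warped product, with values in the
fixed space `F`. -/
def warpedForm (q : M) : TangentSpace I q →L[ℝ] F :=
  (mvfderiv I h q).smulRight e + f.toFun (h q) • mvfderiv I Θ q

variable (f e h Θ) in
/-- The vector `Θ - f'(h) e`. -/
def warpedNormal (q : M) : F := Θ q - deriv f.toFun (h q) • e

variable (I f e h Θ) in
/-- The metric connection `s ↦ ds + ⟨s, dΘ⟩ n - ⟨s, n⟩ dΘ`, where `n = Θ - f'(h) e`, which
restricts to the pullback of the Levi-Civita connection of the warped product on the sections that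
are orthogonal to `Θ`. -/
def warpedDeriv (s : M → F) (q : M) (u : TangentSpace I q) : F :=
  mvfderiv I s q u + (inner ℝ (s q) (mvfderiv I Θ q u) : ℝ) • warpedNormal f e h Θ q
    - (inner ℝ (s q) (warpedNormal f e h Θ q) : ℝ) • mvfderiv I Θ q u

lemma warpedForm_apply (q : M) (u : TangentSpace I q) :
    warpedForm I f e h Θ q u = mvfderiv I h q u • e + f.toFun (h q) • mvfderiv I Θ q u := rfl

lemma WarpingFunction.contDiffAt (f : WarpingFunction J) {t : ℝ} (ht : t ∈ J) :
    ContDiffAt ℝ ∞ f.toFun t :=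
  f.contDiffOn.contDiffAt (J.isOpen.mem_nhds ht)

lemma WarpingFunction.contDiffAt_deriv (f : WarpingFunction J) {t : ℝ} (ht : t ∈ J) :
    ContDiffAt ℝ ∞ (deriv f.toFun) t :=
  (f.contDiffOn.deriv_of_isOpen J.isOpen le_rfl).contDiffAt (J.isOpen.mem_nhds ht)

lemma mvfderiv_comp_real {a : M → ℝ} {g : ℝ → ℝ} {q : M} (hg : DifferentiableAt ℝ g (a q))
    (ha : MDifferentiableAt I 𝓘(ℝ, ℝ) a q) (u : TangentSpace I q) :
    mvfderiv I (fun q => g (a q)) q u = deriv g (a q) * mvfderiv I a q u := by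
  have h := mvfderiv_comp_apply (I := 𝓘(ℝ, ℝ)) (I' := I) (f := a) (g := g) q hg.mdifferentiableAt ha u
  refine h.trans ?_
  have h2 : mvfderiv 𝓘(ℝ, ℝ) g (a q) = fderiv ℝ g (a q) := by
    ext
    exact congrArg (fun L : ℝ →L[ℝ] ℝ => L 1) (mfderiv_eq_fderiv (f := g) (x := a q))
  rw [h2]
  have h3 := (fderiv ℝ g (a q)).map_smul (mvfderiv I a q u) 1
  rw [smul_eq_mul, mul_one, smul_eq_mul, fderiv_apply_one_eq_deriv, mul_comm] at h3
  exact h3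

namespace IsWarpedMap

variable (hw : IsWarpedMap I J e h Θ)
include hw

lemma mdifferentiableAt_height (q : M) : MDifferentiableAt I 𝓘(ℝ, ℝ) h q :=
  hw.height.mdifferentiableAt (by simp)

lemma contMDiffAt_two_height (q : M) : ContMDiffAt I 𝓘(ℝ, ℝ) 2 h q :=
  (hw.height q).of_le ENat.LEInfty.out

lemma contMDiffAt_two_sphere (q : M) : ContMDiffAt I 𝓘(ℝ, F) 2 Θ q :=
  (hw.sphere q).of_le ENat.LEInfty.out

lemma mdifferentiableAt_sphere (q : M) : MDifferentiableAt I 𝓘(ℝ, F) Θ q :=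
  hw.sphere.mdifferentiableAt (by simp)

lemma contMDiff_comp_height : ContMDiff I 𝓘(ℝ, ℝ) ∞ (fun q => f.toFun (h q)) := fun q =>
  (f.contDiffAt (hw.mem q)).contMDiffAt.comp q (hw.height q)

lemma contMDiff_deriv_comp_height : ContMDiff I 𝓘(ℝ, ℝ) ∞ (fun q => deriv f.toFun (h q)) := fun q =>
  (f.contDiffAt_deriv (hw.mem q)).contMDiffAt.comp q (hw.height q)

lemma contMDiff_warpedNormal : ContMDiff I 𝓘(ℝ, F) ∞ (warpedNormal f e h Θ) :=
  hw.sphere.sub (hw.contMDiff_deriv_comp_height.smul contMDiff_const)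

lemma smoothFormAt_warpedForm (q : M) : SmoothFormAt ∞ (warpedForm I f e h Θ) q :=
  ((smoothFormAt_mvfderiv (hw.height q) (by simp)).smulRight e).add
    ((smoothFormAt_mvfderiv (hw.sphere q) (by simp)).smul (hw.contMDiff_comp_height q))

lemma mvfderiv_warpedNormal (q : M) (u : TangentSpace I q) :
    mvfderiv I (warpedNormal f e h Θ) q u =
      mvfderiv I Θ q u - (deriv (deriv f.toFun) (h q) * mvfderiv I h q u) • e := by
  have h1 : MDifferentiableAt I 𝓘(ℝ, ℝ) (fun q => deriv f.toFun (h q)) q :=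
    hw.contMDiff_deriv_comp_height.mdifferentiableAt (by simp)
  have h2 := mvfderiv_fun_sub (hw.mdifferentiableAt_sphere q)
    (h1.smul (mdifferentiableAt_const (c := e)))
  have h3 := congrArg (fun L : TangentSpace I q →L[ℝ] F => L u) h2
  refine h3.trans ?_
  have h4 := mvfderiv_smul_map h1 (mdifferentiableAt_const (I := I) (c := e)) u
  rw [mvfderiv_const, mvfderiv_comp_real ((f.contDiffAt_deriv (hw.mem q)).differentiableAt (by simp))
    (hw.mdifferentiableAt_height q)] at h4
  simpa using! h4

lemma inner_sphere_mvfderiv (q : M) (u : TangentSpace I q) :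
    inner ℝ (Θ q) (mvfderiv I Θ q u) = 0 := by
  have h1 := mvfderiv_inner_map (hw.mdifferentiableAt_sphere q) (hw.mdifferentiableAt_sphere q) u
  have h2 : (fun q => inner ℝ (Θ q) (Θ q)) = fun _ : M => (1 : ℝ) := funext hw.inner_sphere
  rw [h2, mvfderiv_const, real_inner_comm (Θ q)] at h1
  simp at h1
  linarith

lemma inner_axis_mvfderiv (q : M) (u : TangentSpace I q) :
    inner ℝ e (mvfderiv I Θ q u) = 0 := by
  have h1 := mvfderiv_inner_map (mdifferentiableAt_const (I := I) (c := e))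
    (hw.mdifferentiableAt_sphere q) u
  have h2 : (fun q => inner ℝ e (Θ q)) = fun _ : M => (0 : ℝ) := funext hw.inner_axis_sphere
  rw [h2, mvfderiv_const, mvfderiv_const] at h1
  simpa using h1.symm

lemma inner_warpedForm (q : M) (u v : TangentSpace I q) :
    inner ℝ (warpedForm I f e h Θ q u) (warpedForm I f e h Θ q v) =
      mvfderiv I h q u * mvfderiv I h q v +
        f.toFun (h q) ^ 2 * inner ℝ (mvfderiv I Θ q u) (mvfderiv I Θ q v) := by
  have h1 := hw.inner_axis_mvfderiv q u
  rw [real_inner_comm] at h1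
  simp only [warpedForm_apply, inner_add_left, inner_add_right, real_inner_smul_left,
    real_inner_smul_right, hw.inner_axis, hw.inner_axis_mvfderiv, h1]
  ring

lemma inner_axis_warpedForm (q : M) (u : TangentSpace I q) :
    inner ℝ e (warpedForm I f e h Θ q u) = mvfderiv I h q u := by
  rw [warpedForm_apply, inner_add_right, real_inner_smul_right, real_inner_smul_right,
    hw.inner_axis_mvfderiv, hw.inner_axis]
  ring

lemma inner_sphere_warpedForm (q : M) (u : TangentSpace I q) :
    inner ℝ (Θ q) (warpedForm I f e h Θ q u) = 0 := by
  rw [warpedForm_apply, inner_add_right, real_inner_smul_right, real_inner_smul_right,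
    hw.inner_sphere_mvfderiv, real_inner_comm, hw.inner_axis_sphere]
  ring

lemma mdifferentiableAt_warpedForm_apply {p : M} {v : Π q : M, TangentSpace I q}
    (hv : MDiffAt (T% v) p) :
    MDifferentiableAt I 𝓘(ℝ, F) (fun q => warpedForm I f e h Θ q (v q)) p := by
  have h1 := mdifferentiableAt_mvfderiv_apply (hw.contMDiffAt_two_height p) hv
  have h2 := mdifferentiableAt_mvfderiv_apply (hw.contMDiffAt_two_sphere p) hv
  exact (h1.smul (mdifferentiableAt_const (c := e))).add
    ((hw.contMDiff_comp_height.mdifferentiableAt (by simp)).smul h2)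

lemma warpedDeriv_inner {s t : M → F} {p : M} (hs : MDifferentiableAt I 𝓘(ℝ, F) s p)
    (ht : MDifferentiableAt I 𝓘(ℝ, F) t p) (u : TangentSpace I p) :
    mvfderiv I (fun q => inner ℝ (s q) (t q)) p u =
      inner ℝ (warpedDeriv I f e h Θ s p u) (t p) +
        inner ℝ (s p) (warpedDeriv I f e h Θ t p u) := by
  rw [mvfderiv_inner_map hs ht]
  simp only [warpedDeriv, inner_add_left, inner_add_right, inner_sub_left, inner_sub_right,
    real_inner_smul_left, real_inner_smul_right]
  rw [real_inner_comm (t p) (warpedNormal f e h Θ p), real_inner_comm (t p) (mvfderiv I Θ p u)]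
  ring

lemma inner_sphere_warpedDeriv {s : M → F} {p : M} (hs : MDifferentiableAt I 𝓘(ℝ, F) s p)
    (h0 : ∀ᶠ q in 𝓝 p, inner ℝ (Θ q) (s q) = 0) (u : TangentSpace I p) :
    inner ℝ (Θ p) (warpedDeriv I f e h Θ s p u) = 0 := by
  have h1 := hw.warpedDeriv_inner (f := f) (hw.mdifferentiableAt_sphere p) hs u
  have h2 : (fun q => inner ℝ (Θ q) (s q)) =ᶠ[𝓝 p] fun _ => (0 : ℝ) := h0
  rw [mvfderiv_congr h2, mvfderiv_const] at h1
  have h3 : warpedDeriv I f e h Θ Θ p u = 0 := by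
    simp only [warpedDeriv, warpedNormal, inner_sub_right, real_inner_smul_right,
      hw.inner_sphere_mvfderiv, hw.inner_sphere]
    rw [real_inner_comm, hw.inner_axis_sphere]
    simp
  rw [h3] at h1
  simpa using h1.symm

lemma mvfderiv_warpedForm_apply {p : M} {v : Π q : M, TangentSpace I q} (hv : MDiffAt (T% v) p)
    (u : TangentSpace I p) :
    mvfderiv I (fun q => warpedForm I f e h Θ q (v q)) p u =
      mvfderiv I (fun q => mvfderiv I h q (v q)) p u • e +
        ((deriv f.toFun (h p) * mvfderiv I h p u) • mvfderiv I Θ p (v p) +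
          f.toFun (h p) • mvfderiv I (fun q => mvfderiv I Θ q (v q)) p u) := by
  have h1 := mdifferentiableAt_mvfderiv_apply (hw.contMDiffAt_two_height p) hv
  have h2 := mdifferentiableAt_mvfderiv_apply (hw.contMDiffAt_two_sphere p) hv
  have h3 : MDifferentiableAt I 𝓘(ℝ, ℝ) (fun q => f.toFun (h q)) p :=
    hw.contMDiff_comp_height.mdifferentiableAt (by simp)
  have h4 := mvfderiv_fun_add (h1.smul (mdifferentiableAt_const (c := e))) (h3.smul h2)
  refine (congrArg (fun L : TangentSpace I p →L[ℝ] F => L u) h4).trans ?_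
  have h5 := mvfderiv_smul_map h1 (mdifferentiableAt_const (I := I) (c := e)) u
  have h6 := mvfderiv_smul_map h3 h2 u
  rw [mvfderiv_comp_real ((f.contDiffAt (hw.mem p)).differentiableAt (by simp))
    (hw.mdifferentiableAt_height p)] at h6
  rw [mvfderiv_const] at h5
  simp only [zero_apply, smul_zero, add_zero] at h5
  exact congrArg₂ (· + ·) h5 h6

lemma warpedDeriv_torsion_free {p : M} {u v : Π q : M, TangentSpace I q}
    (hu : MDiffAt (T% u) p) (hv : MDiffAt (T% v) p) :
    warpedDeriv I f e h Θ (fun q => warpedForm I f e h Θ q (v q)) p (u p) -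
        warpedDeriv I f e h Θ (fun q => warpedForm I f e h Θ q (u q)) p (v p) =
      warpedForm I f e h Θ p (VectorField.mlieBracket I u v p) := by
  have hh := mvfderiv_mlieBracket (hw.contMDiffAt_two_height p) hu hv
  have hΘ := mvfderiv_mlieBracket (hw.contMDiffAt_two_sphere p) hu hv
  have hn : ∀ a : TangentSpace I p, inner ℝ (warpedForm I f e h Θ p a) (warpedNormal f e h Θ p) =
      -(deriv f.toFun (h p) * mvfderiv I h p a) := by
    intro a
    rw [warpedNormal, inner_sub_right, real_inner_smul_right, real_inner_comm,
      hw.inner_sphere_warpedForm, real_inner_comm, hw.inner_axis_warpedForm]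
    ring
  have hd : ∀ a b : TangentSpace I p, inner ℝ (warpedForm I f e h Θ p a) (mvfderiv I Θ p b) =
      f.toFun (h p) * inner ℝ (mvfderiv I Θ p a) (mvfderiv I Θ p b) := by
    intro a b
    rw [warpedForm_apply, inner_add_left, real_inner_smul_left, real_inner_smul_left,
      hw.inner_axis_mvfderiv]
    ring
  simp only [warpedDeriv, hw.mvfderiv_warpedForm_apply hv, hw.mvfderiv_warpedForm_apply hu, hn, hd]
  rw [warpedForm_apply, hh, hΘ, real_inner_comm (mvfderiv I Θ p (u p))]
  module

/-- The curvature of the connection `warpedDeriv`. -/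
theorem warpedDeriv_curvature {s : M → F} {p : M} (hs : ContMDiffAt I 𝓘(ℝ, F) 2 s p)
    {u v : Π q : M, TangentSpace I q} (hu : MDiffAt (T% u) p) (hv : MDiffAt (T% v) p) :
    warpedDeriv I f e h Θ (fun q => warpedDeriv I f e h Θ s q (v q)) p (u p) -
        warpedDeriv I f e h Θ (fun q => warpedDeriv I f e h Θ s q (u q)) p (v p) -
        warpedDeriv I f e h Θ s p (VectorField.mlieBracket I u v p) =
      (1 - deriv f.toFun (h p) ^ 2) •
        ((inner ℝ (s p) (mvfderiv I Θ p (v p)) : ℝ) • mvfderiv I Θ p (u p) -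
          (inner ℝ (s p) (mvfderiv I Θ p (u p)) : ℝ) • mvfderiv I Θ p (v p)) -
      (deriv (deriv f.toFun) (h p) * mvfderiv I h p (u p)) •
        ((inner ℝ (s p) (mvfderiv I Θ p (v p)) : ℝ) • e -
          (inner ℝ (s p) e : ℝ) • mvfderiv I Θ p (v p)) +
      (deriv (deriv f.toFun) (h p) * mvfderiv I h p (v p)) •
        ((inner ℝ (s p) (mvfderiv I Θ p (u p)) : ℝ) • e -
          (inner ℝ (s p) e : ℝ) • mvfderiv I Θ p (u p)) := by
  have hbs := mvfderiv_mlieBracket hs hu hv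
  have hΘ2 := hw.contMDiffAt_two_sphere p
  have hbΘ := mvfderiv_mlieBracket hΘ2 hu hv
  have hs1 : MDifferentiableAt I 𝓘(ℝ, F) s p := hs.mdifferentiableAt (by simp)
  have hn1 : MDifferentiableAt I 𝓘(ℝ, F) (warpedNormal f e h Θ) p :=
    hw.contMDiff_warpedNormal.mdifferentiableAt (by simp)
  have key : ∀ {a b : Π q : M, TangentSpace I q}, MDiffAt (T% b) p →
      mvfderiv I (fun q => warpedDeriv I f e h Θ s q (b q)) p (a p) =
        mvfderiv I (fun q => mvfderiv I s q (b q)) p (a p) +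
        ((inner ℝ (mvfderiv I s p (a p)) (mvfderiv I Θ p (b p)) +
          inner ℝ (s p) (mvfderiv I (fun q => mvfderiv I Θ q (b q)) p (a p)) : ℝ) •
            warpedNormal f e h Θ p +
          (inner ℝ (s p) (mvfderiv I Θ p (b p)) : ℝ) •
            (mvfderiv I Θ p (a p) - (deriv (deriv f.toFun) (h p) * mvfderiv I h p (a p)) • e)) -
        ((inner ℝ (mvfderiv I s p (a p)) (warpedNormal f e h Θ p) +
          inner ℝ (s p) (mvfderiv I Θ p (a p) -
            (deriv (deriv f.toFun) (h p) * mvfderiv I h p (a p)) • e) : ℝ) • mvfderiv I Θ p (b p) +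
          (inner ℝ (s p) (warpedNormal f e h Θ p) : ℝ) •
            mvfderiv I (fun q => mvfderiv I Θ q (b q)) p (a p)) := by
    intro a b hb
    have h1 := mdifferentiableAt_mvfderiv_apply hs hb
    have h2 := mdifferentiableAt_mvfderiv_apply hΘ2 hb
    have h3 := mdifferentiableAt_inner_map hs1 h2
    have h4 := mdifferentiableAt_inner_map hs1 hn1
    have h5 := mvfderiv_fun_sub (h1.add (h3.smul hn1)) (h4.smul h2)
    have h6 := mvfderiv_fun_add h1 (h3.smul hn1)
    rw [← hw.mvfderiv_warpedNormal, ← mvfderiv_inner_map hs1 h2, ← mvfderiv_inner_map hs1 hn1,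
      ← mvfderiv_smul_map h3 hn1, ← mvfderiv_smul_map h4 h2]
    exact (congrArg (fun L : TangentSpace I p →L[ℝ] F => L (a p)) h5).trans
      (congrArg (fun L : TangentSpace I p →L[ℝ] F => L (a p) - _) h6)
  have hnn : inner ℝ (warpedNormal f e h Θ p) (warpedNormal f e h Θ p) =
      1 + deriv f.toFun (h p) ^ 2 := by
    have h1 := hw.inner_axis_sphere p
    have h2 := h1
    rw [real_inner_comm] at h2
    simp only [warpedNormal, inner_sub_left, inner_sub_right, real_inner_smul_left,
      real_inner_smul_right, hw.inner_axis, hw.inner_sphere, h1, h2]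
    ring
  have hnd : ∀ a : TangentSpace I p, inner ℝ (warpedNormal f e h Θ p) (mvfderiv I Θ p a) = 0 := by
    intro a
    rw [warpedNormal, inner_sub_left, real_inner_smul_left, hw.inner_sphere_mvfderiv,
      hw.inner_axis_mvfderiv]
    ring
  have hdn : ∀ a : TangentSpace I p, inner ℝ (mvfderiv I Θ p a) (warpedNormal f e h Θ p) = 0 :=
    fun a => by rw [real_inner_comm, hnd]
  have exp : ∀ (S : M → F) (a : TangentSpace I p), warpedDeriv I f e h Θ S p a =
    mvfderiv I S p a + (inner ℝ (S p) (mvfderiv I Θ p a) : ℝ) • warpedNormal f e h Θ p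
    - (inner ℝ (S p) (warpedNormal f e h Θ p) : ℝ) • mvfderiv I Θ p a := fun _ _ => rfl
  rw [exp (fun q => warpedDeriv I f e h Θ s q (v q)), exp (fun q => warpedDeriv I f e h Θ s q (u q)),
    key hv, key hu]
  simp only [exp, hbs, hbΘ]
  simp only [inner_add_left, inner_sub_left, inner_sub_right, real_inner_smul_left,
      real_inner_smul_right, hnn, hnd, hdn]
  rw [real_inner_comm (mvfderiv I Θ p (u p)) (mvfderiv I Θ p (v p))]
  module

lemma contMDiffAt_warpedDeriv {s : M → F} {p : M} (hs : ContMDiffAt I 𝓘(ℝ, F) 2 s p)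
    {v : Π q : M, TangentSpace I q} (hv : ContMDiffAt I I.tangent 1 (T% v) p) :
    ContMDiffAt I 𝓘(ℝ, F) 1 (fun q => warpedDeriv I f e h Θ s q (v q)) p := by
  have h0 : ContMDiffAt I 𝓘(ℝ, F) 1 s p := hs.of_le (by norm_num)
  have h1 := contMDiffAt_mvfderiv_apply (m := 1) hs (by norm_num) hv
  have h2 := contMDiffAt_mvfderiv_apply (m := 1) (hw.contMDiffAt_two_sphere p) (by norm_num) hv
  have h3 : ContMDiffAt I 𝓘(ℝ, F) 1 (warpedNormal f e h Θ) p :=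
    (hw.contMDiff_warpedNormal p).of_le ENat.LEInfty.out
  exact (h1.add ((contMDiffAt_inner_map h0 h2).smul h3)).sub ((contMDiffAt_inner_map h0 h3).smul h2)

end IsWarpedMap

end WarpedMap

section ClmApply

variable {E : Type*} [NormedAddCommGroup E] [NormedSpace ℝ E]
  {H : Type*} [TopologicalSpace H] {I : ModelWithCorners ℝ E H}
  {M : Type*} [TopologicalSpace M] [ChartedSpace H M]
  {F : Type*} [NormedAddCommGroup F] [NormedSpace ℝ F]
  {G : Type*} [NormedAddCommGroup G] [NormedSpace ℝ G]

lemma mvfderiv_clm_apply {L : M → G →L[ℝ] F} {c : M → G} {p : M}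
    (hL : MDifferentiableAt I 𝓘(ℝ, G →L[ℝ] F) L p) (hc : MDifferentiableAt I 𝓘(ℝ, G) c p)
    (u : TangentSpace I p) :
    mvfderiv I (fun q => L q (c q)) p u = mvfderiv I L p u (c p) + L p (mvfderiv I c p u) := by
  rw [(hL.clm_apply hc).mvfderiv, hL.mvfderiv, hc.mvfderiv]
  have hL' := hL.differentiableWithinAt_writtenInExtChartAt
  have hc' := hc.differentiableWithinAt_writtenInExtChartAt
  have hx : UniqueDiffWithinAt ℝ (Set.range I) (extChartAt I p p) :=
    I.uniqueDiffOn _ (Set.mem_range_self _)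
  have := congrArg (fun A : E →L[ℝ] F => A u) (fderivWithin_clm_apply hx hL' hc')
  simp only [writtenInExtChartAt, extChartAt_model_space_eq_id, PartialEquiv.refl_coe,
    Function.comp_def, extChartAt_to_inv] at this ⊢
  rw [add_comm]
  exact this

end ClmApply

section LeviCivita

variable {E : Type*} [NormedAddCommGroup E] [NormedSpace ℝ E] [FiniteDimensional ℝ E]
  {H : Type*} [TopologicalSpace H] {I : ModelWithCorners ℝ E H}
  {M : Type*} [TopologicalSpace M] [ChartedSpace H M]
  [RiemannianBundle (fun p : M => TangentSpace I p)]
  [IsManifold I ∞ M] [IsContMDiffRiemannianBundle I ∞ E (fun p : M => TangentSpace I p)]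
  {F : Type*} [NormedAddCommGroup F] [InnerProductSpace ℝ F]
  {J : TopologicalSpace.Opens ℝ} {f : WarpingFunction J} {e : F} {h : M → ℝ} {Θ : M → F}

/-- For an isometric immersion in the warped product, the Levi-Civita connection is the tangential
part of the ambient connection. -/
theorem IsWarpedMap.inner_leviCivita (hw : IsWarpedMap I J e h Θ)
    (hiso : ∀ (q : M) (a b : TangentSpace I q),
      inner ℝ (warpedForm I f e h Θ q a) (warpedForm I f e h Θ q b) = inner ℝ a b)
    {p : M} {X Y Z : Π q : M, TangentSpace I q} (hX : MDiffAt (T% X) p) (hY : MDiffAt (T% Y) p)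
    (hZ : MDiffAt (T% Z) p) :
    inner ℝ (leviCivita I M Y p (X p)) (Z p) =
      inner ℝ (warpedDeriv I f e h Θ (fun q => warpedForm I f e h Θ q (Y q)) p (X p))
        (warpedForm I f e h Θ p (Z p)) := by
  have : CompleteSpace E := FiniteDimensional.complete ℝ E
  let B (X Y Z : Π q : M, TangentSpace I q) : ℝ :=
    inner ℝ (warpedDeriv I f e h Θ (fun q => warpedForm I f e h Θ q (Y q)) p (X p))
        (warpedForm I f e h Θ p (Z p)) - inner ℝ (leviCivita I M Y p (X p)) (Z p)
  have hanti : ∀ {X Y Z : Π q : M, TangentSpace I q}, MDiffAt (T% X) p → MDiffAt (T% Y) p →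
      MDiffAt (T% Z) p → B X Y Z = -B X Z Y := by
    intro X Y Z hX hY hZ
    have h1 := leviCivita_metric hX hY hZ
    have h2 := hw.warpedDeriv_inner (f := f) (hw.mdifferentiableAt_warpedForm_apply (f := f) hY)
      (hw.mdifferentiableAt_warpedForm_apply (f := f) hZ) (X p)
    simp only [hiso] at h2
    rw [h1] at h2
    simp only [B]
    rw [real_inner_comm (leviCivita I M Z p (X p))] at h2
    rw [real_inner_comm (warpedForm I f e h Θ p (Y p))]
    linarith
  have hsymm : ∀ {X Y Z : Π q : M, TangentSpace I q}, MDiffAt (T% X) p → MDiffAt (T% Y) p →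
      MDiffAt (T% Z) p → B X Y Z = B Y X Z := by
    intro X Y Z hX hY hZ
    have h1 := congrArg (fun a => inner ℝ a (Z p)) (leviCivita_torsion_free hX hY)
    have h2 := congrArg (fun a => inner ℝ a (warpedForm I f e h Θ p (Z p)))
      (hw.warpedDeriv_torsion_free (f := f) hX hY)
    simp only [inner_sub_left, hiso] at h1 h2
    simp only [B]
    linarith
  have h1 := hanti hX hY hZ
  have h2 := hsymm hX hZ hY
  have h3 := hanti hZ hX hY
  have h4 := hsymm hZ hY hX
  have h5 := hanti hY hZ hX
  have h6 := hsymm hY hX hZ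
  have h0 : B X Y Z = 0 := by linarith
  simp only [B] at h0
  linarith

end LeviCivita

section WarpedIsometry

variable {E : Type*} [NormedAddCommGroup E] [NormedSpace ℝ E] [FiniteDimensional ℝ E]
  {H : Type*} [TopologicalSpace H] {I : ModelWithCorners ℝ E H}
  {M : Type*} [TopologicalSpace M] [ChartedSpace H M] [IsManifold I ∞ M]
  {E' : Type*} [NormedAddCommGroup E'] [NormedSpace ℝ E'] [FiniteDimensional ℝ E']
  {H' : Type*} [TopologicalSpace H'] {I' : ModelWithCorners ℝ E' H'}
  {N : Type*} [TopologicalSpace N] [ChartedSpace H' N]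
  [RiemannianBundle (fun p : N => TangentSpace I' p)]
  [IsManifold I' ∞ N] [IsContMDiffRiemannianBundle I' ∞ E' (fun p : N => TangentSpace I' p)]
  {F : Type*} [NormedAddCommGroup F] [InnerProductSpace ℝ F]
  {J : TopologicalSpace.Opens ℝ} {f : WarpingFunction J} {e : F} {k : N → ℝ} {Ψ : N → F}

variable (I' f e k Ψ) in
/-- A local isometry `(k, Ψ)` into the warped product of `J` and the unit sphere of the orthogonal
complement of `e`. -/
structure IsWarpedIsometry : Prop extends IsWarpedMap I' J e k Ψ where
  isometry : ∀ (y : N) (a b : TangentSpace I' y),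
    inner ℝ (warpedForm I' f e k Ψ y a) (warpedForm I' f e k Ψ y b) = inner ℝ a b
  surjective : ∀ (y : N) (s : F), inner ℝ (Ψ y) s = 0 →
    ∃ a : TangentSpace I' y, warpedForm I' f e k Ψ y a = s

lemma IsWarpedMap.comp (hN : IsWarpedMap I' J e k Ψ) {x : M → N} (hx : ContMDiff I I' ∞ x) :
    IsWarpedMap I J e (k ∘ x) (Ψ ∘ x) where
  height := hN.height.comp hx
  mem q := hN.mem (x q)
  sphere := hN.sphere.comp hx
  inner_axis := hN.inner_axis
  inner_axis_sphere q := hN.inner_axis_sphere (x q)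
  inner_sphere q := hN.inner_sphere (x q)

namespace IsWarpedIsometry

variable (hN : IsWarpedIsometry I' f e k Ψ)
include hN

lemma injective (y : N) : Function.Injective (warpedForm I' f e k Ψ y) := by
  rw [injective_iff_map_eq_zero]
  intro a ha
  have h := hN.isometry y a a
  rw [ha, inner_zero_left] at h
  exact inner_self_eq_zero.1 h.symm

lemma warpedForm_leviCivita {y : N} {Y : Π z : N, TangentSpace I' z} (hY : MDiffAt (T% Y) y)
    (a : TangentSpace I' y) :
    warpedForm I' f e k Ψ y (leviCivita I' N Y y a) =
      warpedDeriv I' f e k Ψ (fun z => warpedForm I' f e k Ψ z (Y z)) y a := by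
  have : CompleteSpace E' := FiniteDimensional.complete ℝ E'
  obtain ⟨b, hb⟩ := hN.surjective y
    (warpedDeriv I' f e k Ψ (fun z => warpedForm I' f e k Ψ z (Y z)) y a)
    (hN.inner_sphere_warpedDeriv (hN.mdifferentiableAt_warpedForm_apply hY)
      (Filter.Eventually.of_forall fun z => hN.inner_sphere_warpedForm z (Y z)) a)
  rw [← hb]
  congr 1
  refine ext_inner_right ℝ fun c => ?_
  have h1 := hN.toIsWarpedMap.inner_leviCivita hN.isometry
    (X := extend E' a) (Z := extend E' c) (mdifferentiableAt_extend ..) hY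
    (mdifferentiableAt_extend ..)
  rw [extend_apply_self, extend_apply_self, ← hb, hN.isometry] at h1
  exact h1

lemma warpedForm_comp {x : M → N} (hx : ContMDiff I I' ∞ x) (q : M) (u : TangentSpace I q) :
    warpedForm I f e (k ∘ x) (Ψ ∘ x) q u = warpedForm I' f e k Ψ (x q) (mfderiv I I' x q u) := by
  have hxq : MDifferentiableAt I I' x q := hx.mdifferentiableAt (by simp)
  rw [warpedForm_apply, warpedForm_apply,
    mvfderiv_comp_apply q (hN.mdifferentiableAt_height (x q)) hxq]
  have h2 : mvfderiv I (Ψ ∘ x) q u = mvfderiv I' Ψ (x q) (mfderiv I I' x q u) :=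
    mfderiv_comp_apply q (hN.mdifferentiableAt_sphere (x q)) hxq u
  rw [h2]
  rfl

/-- The covariant derivative of vector fields along a map, in terms of functions with values in
the fixed space `F`. -/
theorem warpedForm_alongDeriv {x : M → N} (hx : ContMDiff I I' ∞ x) {p : M}
    {V : Π q : M, TangentSpace I' (x q)}
    (hV : ContMDiffAt I I'.tangent 1 (fun q => (⟨x q, V q⟩ : TangentBundle I' N)) p)
    (u : TangentSpace I p) :
    warpedForm I' f e k Ψ (x p) (alongDeriv I I' x V p u) =
      warpedDeriv I f e (k ∘ x) (Ψ ∘ x) (fun q => warpedForm I' f e k Ψ (x q) (V q)) p u := by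
  have hxp : MDifferentiableAt I I' x p := hx.mdifferentiableAt (by simp)
  have hmem := mem_baseSet_trivializationAt E' (TangentSpace I' : N → Type _) (x p)
  set t := trivializationAt E' (TangentSpace I' : N → Type _) (x p) with ht
  let c : M → E' := fun q => (t (⟨x q, V q⟩ : TangentBundle I' N)).2
  have hc : MDifferentiableAt I 𝓘(ℝ, E') c p :=
    (contMDiffAt_totalSpace.1 hV).2.mdifferentiableAt one_ne_zero
  let C : N → E' →L[ℝ] F := coordForm (warpedForm I' f e k Ψ) (x p)
  have hC : MDifferentiableAt I' 𝓘(ℝ, E' →L[ℝ] F) C (x p) :=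
    ContMDiffAt.mdifferentiableAt (hN.smoothFormAt_warpedForm (f := f) (x p)) (by simp)
  have hCx : MDifferentiableAt I 𝓘(ℝ, E' →L[ℝ] F) (C ∘ x) p := hC.comp p hxp
  have hnhds : ∀ᶠ y in 𝓝 (x p), y ∈ t.baseSet := t.open_baseSet.mem_nhds hmem
  have h1 : (fun q => warpedForm I' f e k Ψ (x q) (V q)) =ᶠ[𝓝 p] fun q => (C ∘ x) q (c q) := by
    filter_upwards [hx.continuous.continuousAt.eventually hnhds] with q hq
    exact (coordForm_apply_trivialization (warpedForm I' f e k Ψ) hq (V q)).symm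
  have h2 : (fun y => warpedForm I' f e k Ψ y (extend E' (V p) y)) =ᶠ[𝓝 (x p)]
      fun y => C y (c p) := by
    filter_upwards [hnhds] with y hy
    simp only [C, coordForm, ContinuousLinearMap.comp_apply]
    rw [Trivialization.symmL_apply _ hy]
    rfl
  have h3 : mvfderiv I (C ∘ x) p u = mvfderiv I' C (x p) (mfderiv I I' x p u) :=
    mfderiv_comp_apply p hC hxp u
  have h4 : mvfderiv I (Ψ ∘ x) p u = mvfderiv I' Ψ (x p) (mfderiv I I' x p u) :=
    mfderiv_comp_apply p (hN.mdifferentiableAt_sphere (x p)) hxp u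
  have h5 : warpedForm I' f e k Ψ (x p) (t.symm (x p) (mfderiv I 𝓘(ℝ, E') c p u)) =
      C (x p) (mvfderiv I c p u) := by
    simp only [C, coordForm, ContinuousLinearMap.comp_apply]
    rw [Trivialization.symmL_apply _ hmem]
    rfl
  have h6 : mvfderiv I' (fun y => C y (c p)) (x p) (mfderiv I I' x p u) =
      mvfderiv I' C (x p) (mfderiv I I' x p u) (c p) := by
    rw [mvfderiv_clm_apply hC mdifferentiableAt_const, mvfderiv_const]
    simp
  rw [alongDeriv, map_add, hN.warpedForm_leviCivita (mdifferentiableAt_extend ..)]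
  refine (congrArg (· + _) h5).trans ?_
  rw [warpedDeriv, warpedDeriv, mvfderiv_congr h1, mvfderiv_congr h2,
    mvfderiv_clm_apply hCx hc, h3, h4, h6, extend_apply_self]
  change C (x p) (mvfderiv I c p u) + (_ + _ • warpedNormal f e k Ψ (x p) - _) =
    (_ + C (x p) (mvfderiv I c p u) + _ • warpedNormal f e k Ψ (x p) - _)
  abel

variable {x : M → N} (hx : ContMDiff I I' ∞ x)
include hx

lemma contMDiffAt_along_iff {m : ℕ∞ω} (hm : m ≤ ∞) {p : M} {V : Π q : M, TangentSpace I' (x q)} :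
    ContMDiffAt I I'.tangent m (fun q => (⟨x q, V q⟩ : TangentBundle I' N)) p ↔
      ContMDiffAt I 𝓘(ℝ, F) m (fun q => warpedForm I' f e k Ψ (x q) (V q)) p := by
  have h : SmoothFormAt m (warpedForm I' f e k Ψ) (x p) :=
    ContMDiffAt.of_le (hN.smoothFormAt_warpedForm (f := f) (x p)) hm
  exact ⟨fun hV => h.apply_along hV, fun hV => h.contMDiffAt_of_inner (hN.injective _)
    ((hx p).of_le hm) hV (Filter.Eventually.of_forall fun q a => rfl)⟩

lemma contMDiffAt_mfderiv_apply {m : ℕ∞ω} (hm : m ≤ ∞) {p : M} {v : Π q : M, TangentSpace I q}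
    (hv : ContMDiffAt I I.tangent m (T% v) p) :
    ContMDiffAt I I'.tangent m
      (fun q => (⟨x q, mfderiv I I' x q (v q)⟩ : TangentBundle I' N)) p := by
  rw [hN.contMDiffAt_along_iff hx hm]
  simp only [← hN.warpedForm_comp hx]
  have h : SmoothFormAt m (warpedForm I f e (k ∘ x) (Ψ ∘ x)) p :=
    ContMDiffAt.of_le ((hN.toIsWarpedMap.comp hx).smoothFormAt_warpedForm (f := f) p) hm
  exact h.apply_along (x := id) hv

lemma contMDiffAt_alongDeriv {p : M} {V : Π q : M, TangentSpace I' (x q)}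
    (hV : ContMDiffAt I I'.tangent 2 (fun q => (⟨x q, V q⟩ : TangentBundle I' N)) p)
    {v : Π q : M, TangentSpace I q} (hv : ContMDiffAt I I.tangent 1 (T% v) p) :
    ContMDiffAt I I'.tangent 1
      (fun q => (⟨x q, alongDeriv I I' x V q (v q)⟩ : TangentBundle I' N)) p := by
  have : CompleteSpace E := FiniteDimensional.complete ℝ E
  rw [hN.contMDiffAt_along_iff hx ENat.LEInfty.out]
  have h2 := (hN.contMDiffAt_along_iff hx (m := 2) ENat.LEInfty.out).1 hV
  refine ((hN.toIsWarpedMap.comp hx).contMDiffAt_warpedDeriv (f := f) h2 hv).congr_of_eventuallyEq ?_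
  filter_upwards [(contMDiffAt_iff_contMDiffAt_nhds (by simp)).1 hV] with q hq
  exact hN.warpedForm_alongDeriv hx (hq.of_le (by norm_num)) (v q)

lemma contMDiffAt_along_add {m : ℕ∞ω} (hm : m ≤ ∞) {p : M} {V W : Π q : M, TangentSpace I' (x q)}
    (hV : ContMDiffAt I I'.tangent m (fun q => (⟨x q, V q⟩ : TangentBundle I' N)) p)
    (hW : ContMDiffAt I I'.tangent m (fun q => (⟨x q, W q⟩ : TangentBundle I' N)) p) :
    ContMDiffAt I I'.tangent m (fun q => (⟨x q, V q + W q⟩ : TangentBundle I' N)) p := by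
  rw [hN.contMDiffAt_along_iff hx hm] at hV hW ⊢
  simp only [map_add]
  exact hV.add hW

lemma contMDiffAt_along_sub {m : ℕ∞ω} (hm : m ≤ ∞) {p : M} {V W : Π q : M, TangentSpace I' (x q)}
    (hV : ContMDiffAt I I'.tangent m (fun q => (⟨x q, V q⟩ : TangentBundle I' N)) p)
    (hW : ContMDiffAt I I'.tangent m (fun q => (⟨x q, W q⟩ : TangentBundle I' N)) p) :
    ContMDiffAt I I'.tangent m (fun q => (⟨x q, V q - W q⟩ : TangentBundle I' N)) p := by
  rw [hN.contMDiffAt_along_iff hx hm] at hV hW ⊢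
  simp only [map_sub]
  exact hV.sub hW

lemma alongDeriv_add_field {p : M} {V W : Π q : M, TangentSpace I' (x q)}
    (hV : ContMDiffAt I I'.tangent 1 (fun q => (⟨x q, V q⟩ : TangentBundle I' N)) p)
    (hW : ContMDiffAt I I'.tangent 1 (fun q => (⟨x q, W q⟩ : TangentBundle I' N)) p)
    (u : TangentSpace I p) :
    alongDeriv I I' x (fun q => V q + W q) p u =
      alongDeriv I I' x V p u + alongDeriv I I' x W p u := by
  apply hN.injective
  have h1 : (1 : ℕ∞ω) ≤ ∞ := ENat.LEInfty.out
  rw [map_add, hN.warpedForm_alongDeriv hx hV, hN.warpedForm_alongDeriv hx hW,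
    hN.warpedForm_alongDeriv hx (hN.contMDiffAt_along_add hx h1 hV hW)]
  have hV' := ((hN.contMDiffAt_along_iff hx h1).1 hV).mdifferentiableAt one_ne_zero
  have hW' := ((hN.contMDiffAt_along_iff hx h1).1 hW).mdifferentiableAt one_ne_zero
  have h2 := congrArg (fun L : TangentSpace I p →L[ℝ] F => L u) (mvfderiv_fun_add hV' hW')
  simp only [warpedDeriv, map_add, inner_add_left]
  rw [h2, _root_.add_apply]
  module

lemma alongDeriv_inner {p : M} {V W : Π q : M, TangentSpace I' (x q)}
    (hV : ContMDiffAt I I'.tangent 1 (fun q => (⟨x q, V q⟩ : TangentBundle I' N)) p)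
    (hW : ContMDiffAt I I'.tangent 1 (fun q => (⟨x q, W q⟩ : TangentBundle I' N)) p)
    (u : TangentSpace I p) :
    mvfderiv I (fun q => inner ℝ (V q) (W q)) p u =
      inner ℝ (alongDeriv I I' x V p u) (W p) + inner ℝ (V p) (alongDeriv I I' x W p u) := by
  have : CompleteSpace E := FiniteDimensional.complete ℝ E
  have h1 : (1 : ℕ∞ω) ≤ ∞ := ENat.LEInfty.out
  have hV' := ((hN.contMDiffAt_along_iff hx h1).1 hV).mdifferentiableAt one_ne_zero
  have hW' := ((hN.contMDiffAt_along_iff hx h1).1 hW).mdifferentiableAt one_ne_zero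
  have h2 := (hN.toIsWarpedMap.comp hx).warpedDeriv_inner (f := f) hV' hW' u
  rw [← hN.warpedForm_alongDeriv hx hV, ← hN.warpedForm_alongDeriv hx hW] at h2
  simpa only [hN.isometry] using h2

lemma alongDeriv_torsion_free {p : M} {u v : Π q : M, TangentSpace I q}
    (hu : ContMDiffAt I I.tangent 1 (T% u) p) (hv : ContMDiffAt I I.tangent 1 (T% v) p) :
    alongDeriv I I' x (fun q => mfderiv I I' x q (v q)) p (u p) -
        alongDeriv I I' x (fun q => mfderiv I I' x q (u q)) p (v p) =
      mfderiv I I' x p (VectorField.mlieBracket I u v p) := by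
  have : CompleteSpace E := FiniteDimensional.complete ℝ E
  apply hN.injective
  have h1 : (1 : ℕ∞ω) ≤ ∞ := ENat.LEInfty.out
  rw [map_sub, hN.warpedForm_alongDeriv hx (hN.contMDiffAt_mfderiv_apply hx h1 hv),
    hN.warpedForm_alongDeriv hx (hN.contMDiffAt_mfderiv_apply hx h1 hu)]
  simp only [← hN.warpedForm_comp hx]
  exact (hN.toIsWarpedMap.comp hx).warpedDeriv_torsion_free (hu.mdifferentiableAt one_ne_zero)
    (hv.mdifferentiableAt one_ne_zero)

end IsWarpedIsometry

end WarpedIsometry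

lemma bracket4_eq {V : Type*} [NormedAddCommGroup V] [InnerProductSpace ℝ V] (a b c d : V) :
    bracket4 a b c d = inner ℝ b c * inner ℝ a d - inner ℝ a c * inner ℝ b d := by
  rw [bracket4, inner_sub_left, real_inner_smul_left, real_inner_smul_left]

lemma inner_warped_curvature {F : Type*} [NormedAddCommGroup F] [InnerProductSpace ℝ F]
    {e U V : F} (he : inner ℝ e e = (1 : ℝ)) (hU : inner ℝ e U = (0 : ℝ))
    (hV : inner ℝ e V = (0 : ℝ)) {c : ℝ} (hc : c ≠ 0) (a b d g : ℝ) (S W : F) :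
    inner ℝ ((1 - d ^ 2) • ((inner ℝ S V : ℝ) • U - (inner ℝ S U : ℝ) • V)
        - (g * a) • ((inner ℝ S V : ℝ) • e - (inner ℝ S e : ℝ) • V)
        + (g * b) • ((inner ℝ S U : ℝ) • e - (inner ℝ S e : ℝ) • U)) W =
      (1 - d ^ 2) / c ^ 2 * bracket4 (a • e + c • U) (b • e + c • V) S W +
      ((1 - d ^ 2) / c ^ 2 + g / c) *
        (inner ℝ S e * bracket4 (b • e + c • V) (a • e + c • U) e W +
          bracket4 (b • e + c • V) (a • e + c • U) S e * inner ℝ e W) := by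
  have hU' : inner ℝ U e = (0 : ℝ) := by rw [real_inner_comm, hU]
  have hV' : inner ℝ V e = (0 : ℝ) := by rw [real_inner_comm, hV]
  simp only [bracket4_eq, inner_add_left, inner_sub_left, real_inner_smul_left, he, hU', hV',
    real_inner_comm S, inner_add_right, real_inner_smul_right]
  field_simp
  ring

lemma warpedDeriv_congr {E : Type*} [NormedAddCommGroup E] [NormedSpace ℝ E]
    {H : Type*} [TopologicalSpace H] {I : ModelWithCorners ℝ E H}
    {M : Type*} [TopologicalSpace M] [ChartedSpace H M] [IsManifold I ∞ M]
    {F : Type*} [NormedAddCommGroup F] [InnerProductSpace ℝ F]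
    {J : TopologicalSpace.Opens ℝ} {f : WarpingFunction J} {e : F} {h : M → ℝ} {Θ : M → F}
    {s t : M → F} {p : M} (hst : s =ᶠ[𝓝 p] t) (u : TangentSpace I p) :
    warpedDeriv I f e h Θ s p u = warpedDeriv I f e h Θ t p u := by
  rw [warpedDeriv, warpedDeriv, mvfderiv_congr hst, hst.self_of_nhds]

section WarpedCurvature

variable {E : Type*} [NormedAddCommGroup E] [NormedSpace ℝ E] [FiniteDimensional ℝ E]
  {H : Type*} [TopologicalSpace H] {I : ModelWithCorners ℝ E H}
  {M : Type*} [TopologicalSpace M] [ChartedSpace H M] [IsManifold I ∞ M]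
  {E' : Type*} [NormedAddCommGroup E'] [NormedSpace ℝ E'] [FiniteDimensional ℝ E']
  {H' : Type*} [TopologicalSpace H'] {I' : ModelWithCorners ℝ E' H'}
  {N : Type*} [TopologicalSpace N] [ChartedSpace H' N]
  [RiemannianBundle (fun p : N => TangentSpace I' p)]
  [IsManifold I' ∞ N] [IsContMDiffRiemannianBundle I' ∞ E' (fun p : N => TangentSpace I' p)]
  {F : Type*} [NormedAddCommGroup F] [InnerProductSpace ℝ F]
  {J : TopologicalSpace.Opens ℝ} {f : WarpingFunction J} {e : F} {k : N → ℝ} {Ψ : N → F}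

namespace IsWarpedIsometry

variable (hN : IsWarpedIsometry I' f e k Ψ) {x : M → N} (hx : ContMDiff I I' ∞ x)
include hN hx

lemma alongDeriv_congr {p : M} {V W : Π q : M, TangentSpace I' (x q)}
    (hV : ContMDiffAt I I'.tangent 1 (fun q => (⟨x q, V q⟩ : TangentBundle I' N)) p)
    (hW : ContMDiffAt I I'.tangent 1 (fun q => (⟨x q, W q⟩ : TangentBundle I' N)) p)
    (hVW : ∀ᶠ q in 𝓝 p, V q = W q) (u : TangentSpace I p) :
    alongDeriv I I' x V p u = alongDeriv I I' x W p u := by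
  apply hN.injective
  rw [hN.warpedForm_alongDeriv hx hV, hN.warpedForm_alongDeriv hx hW]
  refine warpedDeriv_congr ?_ u
  filter_upwards [hVW] with q hq
  rw [hq]

/-- The curvature of the warped product, for vector fields along a map. -/
theorem inner_curvature_alongDeriv {p : M} {V : Π q : M, TangentSpace I' (x q)}
    (hV : ContMDiffAt I I'.tangent 2 (fun q => (⟨x q, V q⟩ : TangentBundle I' N)) p)
    {u v : Π q : M, TangentSpace I q}
    (hu : ContMDiffAt I I.tangent 1 (T% u) p) (hv : ContMDiffAt I I.tangent 1 (T% v) p)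
    {τ : TangentSpace I' (x p)} (hτ : warpedForm I' f e k Ψ (x p) τ = e)
    (W : TangentSpace I' (x p)) :
    inner ℝ (alongDeriv I I' x (fun q => alongDeriv I I' x V q (v q)) p (u p)
        - alongDeriv I I' x (fun q => alongDeriv I I' x V q (u q)) p (v p)
        - alongDeriv I I' x V p (VectorField.mlieBracket I u v p)) W =
      f.lam (k (x p)) * bracket4 (mfderiv I I' x p (u p)) (mfderiv I I' x p (v p)) (V p) W +
      f.mu (k (x p)) * (inner ℝ (V p) τ *
          bracket4 (mfderiv I I' x p (v p)) (mfderiv I I' x p (u p)) τ W +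
        bracket4 (mfderiv I I' x p (v p)) (mfderiv I I' x p (u p)) (V p) τ * inner ℝ τ W) := by
  have : CompleteSpace E := FiniteDimensional.complete ℝ E
  have hV1 : ContMDiffAt I I'.tangent 1 (fun q => (⟨x q, V q⟩ : TangentBundle I' N)) p :=
    hV.of_le (by norm_num)
  have hs := (hN.contMDiffAt_along_iff hx (m := 2) ENat.LEInfty.out).1 hV
  have hM := hN.toIsWarpedMap.comp hx
  have hcongr : ∀ v : Π q : M, TangentSpace I q,
      (fun q => warpedForm I' f e k Ψ (x q) (alongDeriv I I' x V q (v q))) =ᶠ[𝓝 p]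
      fun q => warpedDeriv I f e (k ∘ x) (Ψ ∘ x)
        (fun q => warpedForm I' f e k Ψ (x q) (V q)) q (v q) := by
    intro v
    filter_upwards [(contMDiffAt_iff_contMDiffAt_nhds (by simp)).1 hV] with q hq
    exact hN.warpedForm_alongDeriv hx (hq.of_le (by norm_num)) (v q)
  have hcurv := hM.warpedDeriv_curvature (f := f) hs (hu.mdifferentiableAt one_ne_zero)
    (hv.mdifferentiableAt one_ne_zero)
  rw [← warpedDeriv_congr (hcongr v), ← warpedDeriv_congr (hcongr u),
    ← hN.warpedForm_alongDeriv hx (hN.contMDiffAt_alongDeriv hx hV hv),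
    ← hN.warpedForm_alongDeriv hx (hN.contMDiffAt_alongDeriv hx hV hu),
    ← hN.warpedForm_alongDeriv hx hV1, ← map_sub, ← map_sub] at hcurv
  rw [← hN.isometry, hcurv]
  have hf : f.toFun ((k ∘ x) p) ≠ 0 := (f.pos _ (hM.mem p)).ne'
  rw [inner_warped_curvature hM.inner_axis (hM.inner_axis_mvfderiv p (u p))
    (hM.inner_axis_mvfderiv p (v p)) hf]
  simp only [← warpedForm_apply (f := f), bracket4_eq, ← hN.isometry (x p), hτ,
    ← hN.warpedForm_comp hx]
  rfl

end IsWarpedIsometry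

end WarpedCurvature

section NormalPart

variable {E : Type*} [NormedAddCommGroup E] [NormedSpace ℝ E] [FiniteDimensional ℝ E]
  {H : Type*} [TopologicalSpace H] {I : ModelWithCorners ℝ E H}
  {M : Type*} [TopologicalSpace M] [ChartedSpace H M]
  [RiemannianBundle (fun p : M => TangentSpace I p)]
  {E' : Type*} [NormedAddCommGroup E'] [NormedSpace ℝ E'] [FiniteDimensional ℝ E']
  {H' : Type*} [TopologicalSpace H'] {I' : ModelWithCorners ℝ E' H'}
  {N : Type*} [TopologicalSpace N] [ChartedSpace H' N]
  [RiemannianBundle (fun p : N => TangentSpace I' p)] {x : M → N} {p : M}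

lemma inner_tangentPart (V : TangentSpace I' (x p)) (a : TangentSpace I p) :
    inner ℝ (tangentPart I I' x p V) a = inner ℝ V (mfderiv I I' x p a) :=
  ContinuousLinearMap.adjoint_inner_left _ _ _

lemma normalPart_add (V W : TangentSpace I' (x p)) :
    normalPart I I' x p (V + W) = normalPart I I' x p V + normalPart I I' x p W := by
  simp only [normalPart, tangentPart, map_add]
  abel

lemma normalPart_sub (V W : TangentSpace I' (x p)) :
    normalPart I I' x p (V - W) = normalPart I I' x p V - normalPart I I' x p W := by
  simp only [normalPart, tangentPart, map_sub]
  abel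

lemma normalPart_smul (c : ℝ) (V : TangentSpace I' (x p)) :
    normalPart I I' x p (c • V) = c • normalPart I I' x p V := by
  simp only [normalPart, tangentPart, map_smul, smul_sub]

lemma IsNormalAt.tangentPart_eq_zero {V : TangentSpace I' (x p)} (hV : IsNormalAt I I' x p V) :
    tangentPart I I' x p V = 0 := by
  refine ext_inner_right ℝ fun a => ?_
  rw [inner_tangentPart, hV, inner_zero_left]

lemma IsNormalAt.normalPart_eq {V : TangentSpace I' (x p)} (hV : IsNormalAt I I' x p V) :
    normalPart I I' x p V = V := by
  rw [normalPart, hV.tangentPart_eq_zero, map_zero, sub_zero]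

lemma IsNormalAt.inner_mfderiv_left {V : TangentSpace I' (x p)} (hV : IsNormalAt I I' x p V)
    (a : TangentSpace I p) : inner ℝ (mfderiv I I' x p a) V = 0 := by
  rw [real_inner_comm]
  exact hV a

lemma inner_normalPart_left {V W : TangentSpace I' (x p)} (hW : IsNormalAt I I' x p W) :
    inner ℝ (normalPart I I' x p V) W = inner ℝ V W := by
  rw [normalPart, inner_sub_left, hW.inner_mfderiv_left, sub_zero]

variable (hx : IsIsometricImmersion I I' x)
include hx

lemma IsIsometricImmersion.tangentPart_mfderiv (a : TangentSpace I p) :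
    tangentPart I I' x p (mfderiv I I' x p a) = a := by
  refine ext_inner_right ℝ fun b => ?_
  rw [inner_tangentPart, hx.inner_mfderiv]

lemma IsIsometricImmersion.normalPart_mfderiv (a : TangentSpace I p) :
    normalPart I I' x p (mfderiv I I' x p a) = 0 := by
  rw [normalPart, hx.tangentPart_mfderiv, sub_self]

lemma IsIsometricImmersion.isNormalAt_normalPart (V : TangentSpace I' (x p)) :
    IsNormalAt I I' x p (normalPart I I' x p V) := by
  intro a
  rw [normalPart, inner_sub_left, hx.inner_mfderiv, inner_tangentPart, sub_self]

lemma IsIsometricImmersion.inner_normalPart_comm (V W : TangentSpace I' (x p)) :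
    inner ℝ (normalPart I I' x p V) W = inner ℝ V (normalPart I I' x p W) := by
  rw [← inner_normalPart_left (hx.isNormalAt_normalPart W), real_inner_comm,
    ← inner_normalPart_left (hx.isNormalAt_normalPart V), real_inner_comm]

end NormalPart

section FundamentalEquations

variable {E : Type*} [NormedAddCommGroup E] [NormedSpace ℝ E] [FiniteDimensional ℝ E]
  {H : Type*} [TopologicalSpace H] {I : ModelWithCorners ℝ E H}
  {M : Type*} [TopologicalSpace M] [ChartedSpace H M]
  [RiemannianBundle (fun p : M => TangentSpace I p)]
  [IsManifold I ∞ M] [IsContMDiffRiemannianBundle I ∞ E (fun p : M => TangentSpace I p)]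
  {E' : Type*} [NormedAddCommGroup E'] [NormedSpace ℝ E'] [FiniteDimensional ℝ E']
  {H' : Type*} [TopologicalSpace H'] {I' : ModelWithCorners ℝ E' H'}
  {N : Type*} [TopologicalSpace N] [ChartedSpace H' N]
  [RiemannianBundle (fun p : N => TangentSpace I' p)]
  [IsManifold I' ∞ N] [IsContMDiffRiemannianBundle I' ∞ E' (fun p : N => TangentSpace I' p)]
  {F : Type*} [NormedAddCommGroup F] [InnerProductSpace ℝ F]
  {J : TopologicalSpace.Opens ℝ} {f : WarpingFunction J} {e : F} {k : N → ℝ} {Ψ : N → F}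

namespace IsWarpedIsometry

variable (hN : IsWarpedIsometry I' f e k Ψ) {x : M → N}
include hN

section Smooth

variable (hx : ContMDiff I I' ∞ x)
include hx

lemma alongDeriv_add_vector {p : M} {V : Π q : M, TangentSpace I' (x q)}
    (hV : ContMDiffAt I I'.tangent 1 (fun q => (⟨x q, V q⟩ : TangentBundle I' N)) p)
    (u v : TangentSpace I p) :
    alongDeriv I I' x V p (u + v) = alongDeriv I I' x V p u + alongDeriv I I' x V p v := by
  apply hN.injective
  rw [map_add]
  simp only [hN.warpedForm_alongDeriv hx hV, warpedDeriv, map_add, inner_add_right]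
  module

lemma alongDeriv_smul_vector {p : M} {V : Π q : M, TangentSpace I' (x q)}
    (hV : ContMDiffAt I I'.tangent 1 (fun q => (⟨x q, V q⟩ : TangentBundle I' N)) p)
    (c : ℝ) (u : TangentSpace I p) :
    alongDeriv I I' x V p (c • u) = c • alongDeriv I I' x V p u := by
  apply hN.injective
  rw [map_smul]
  simp only [hN.warpedForm_alongDeriv hx hV, warpedDeriv, map_smul, real_inner_smul_right]
  module

end Smooth

variable (hx : IsIsometricImmersion I I' x)
include hx

lemma leviCivita_eq_tangentPart {p : M} {v : Π q : M, TangentSpace I q}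
    (hv : ContMDiffAt I I.tangent 1 (T% v) p) (u : TangentSpace I p) :
    leviCivita I M v p u =
      tangentPart I I' x p (alongDeriv I I' x (fun q => mfderiv I I' x q (v q)) p u) := by
  refine ext_inner_right ℝ fun w => ?_
  have hM := hN.toIsWarpedMap.comp hx.contMDiff
  have hiso : ∀ (q : M) (a b : TangentSpace I q),
      inner ℝ (warpedForm I f e (k ∘ x) (Ψ ∘ x) q a) (warpedForm I f e (k ∘ x) (Ψ ∘ x) q b) =
        inner ℝ a b := by
    intro q a b
    rw [hN.warpedForm_comp hx.contMDiff, hN.warpedForm_comp hx.contMDiff, hN.isometry,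
      hx.inner_mfderiv]
  have h := hM.inner_leviCivita hiso (X := extend E u) (Z := extend E w)
    (mdifferentiableAt_extend ..) (hv.mdifferentiableAt one_ne_zero) (mdifferentiableAt_extend ..)
  rw [extend_apply_self, extend_apply_self] at h
  simp only [hN.warpedForm_comp hx.contMDiff] at h
  rw [h, inner_tangentPart, ← hN.isometry, hN.warpedForm_alongDeriv hx.contMDiff
    (hN.contMDiffAt_mfderiv_apply hx.contMDiff ENat.LEInfty.out hv)]

lemma contMDiffAt_tangentPart {m : ℕ∞ω} (hm : m ≤ ∞) {p : M} {V : Π q : M, TangentSpace I' (x q)}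
    (hV : ContMDiffAt I I'.tangent m (fun q => (⟨x q, V q⟩ : TangentBundle I' N)) p) :
    ContMDiffAt I I.tangent m (T% (fun q => tangentPart I I' x q (V q))) p := by
  have h : SmoothFormAt m (warpedForm I f e (k ∘ x) (Ψ ∘ x)) p :=
    ContMDiffAt.of_le ((hN.toIsWarpedMap.comp hx.contMDiff).smoothFormAt_warpedForm (f := f) p) hm
  refine h.contMDiffAt_of_inner (x := id) ?_ contMDiffAt_id
    ((hN.contMDiffAt_along_iff hx.contMDiff hm).1 hV) (Filter.Eventually.of_forall fun q a => ?_)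
  · rw [injective_iff_map_eq_zero]
    intro a ha
    change warpedForm I f e (k ∘ x) (Ψ ∘ x) p a = 0 at ha
    have h1 := hx.inner_mfderiv p a a
    rw [hN.warpedForm_comp hx.contMDiff] at ha
    rw [← hN.isometry, ha, inner_zero_left] at h1
    exact inner_self_eq_zero.1 h1.symm
  · change inner ℝ (warpedForm I f e (k ∘ x) (Ψ ∘ x) q _) (warpedForm I f e (k ∘ x) (Ψ ∘ x) q a) =
      inner ℝ _ (warpedForm I f e (k ∘ x) (Ψ ∘ x) q a)
    rw [hN.warpedForm_comp hx.contMDiff, hN.warpedForm_comp hx.contMDiff, hN.isometry, hN.isometry,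
      hx.inner_mfderiv, inner_tangentPart]

lemma contMDiffAt_leviCivita {p : M} {u v : Π q : M, TangentSpace I q}
    (hu : ContMDiffAt I I.tangent 1 (T% u) p) (hv : ContMDiffAt I I.tangent 2 (T% v) p) :
    ContMDiffAt I I.tangent 1 (T% (fun q => leviCivita I M v q (u q))) p := by
  have h1 := hN.contMDiffAt_tangentPart hx ENat.LEInfty.out
    (hN.contMDiffAt_alongDeriv hx.contMDiff
      (hN.contMDiffAt_mfderiv_apply hx.contMDiff ENat.LEInfty.out hv) hu)
  refine h1.congr_of_eventuallyEq ?_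
  filter_upwards [(contMDiffAt_iff_contMDiffAt_nhds (by simp)).1 hv] with q hq
  rw [hN.leviCivita_eq_tangentPart hx (hq.of_le (by norm_num))]

/-- The Gauss formula. -/
theorem alongDeriv_mfderiv {p : M} {w : Π q : M, TangentSpace I q}
    (hw : ContMDiffAt I I.tangent 1 (T% w) p) (u : TangentSpace I p) :
    alongDeriv I I' x (fun q => mfderiv I I' x q (w q)) p u =
      mfderiv I I' x p (leviCivita I M w p u) + secondFundamentalForm I I' x p u (w p) := by
  have hsplit : ∀ {v : Π q : M, TangentSpace I q} (_ : ContMDiffAt I I.tangent 1 (T% v) p)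
      (a : TangentSpace I p), normalPart I I' x p
        (alongDeriv I I' x (fun q => mfderiv I I' x q (v q)) p a) =
        alongDeriv I I' x (fun q => mfderiv I I' x q (v q)) p a -
          mfderiv I I' x p (leviCivita I M v p a) := by
    intro v hv a
    rw [hN.leviCivita_eq_tangentPart hx hv, normalPart]
  have hsymm : ∀ {v v' : Π q : M, TangentSpace I q} (_ : ContMDiffAt I I.tangent 1 (T% v) p)
      (_ : ContMDiffAt I I.tangent 1 (T% v') p), normalPart I I' x p
        (alongDeriv I I' x (fun q => mfderiv I I' x q (v q)) p (v' p)) =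
      normalPart I I' x p (alongDeriv I I' x (fun q => mfderiv I I' x q (v' q)) p (v p)) := by
    intro v v' hv hv'
    rw [← sub_eq_zero, ← normalPart_sub, hN.alongDeriv_torsion_free hx.contMDiff hv' hv,
      hx.normalPart_mfderiv]
  have hu' : ContMDiffAt I I.tangent 1 (T% (extend E u)) p := contMDiffAt_extend ..
  have hw' : ContMDiffAt I I.tangent 1 (T% (extend E (w p))) p := contMDiffAt_extend ..
  have h1 := hsymm hw hu'
  have h2 := hsymm hw' hu'
  rw [extend_apply_self] at h1 h2
  rw [extend_apply_self] at h2
  rw [secondFundamentalForm, h2, ← h1, hsplit hw]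
  abel

lemma secondFundamentalForm_eq {p : M} {w : Π q : M, TangentSpace I q}
    (hw : ContMDiffAt I I.tangent 1 (T% w) p) (u : TangentSpace I p) :
    secondFundamentalForm I I' x p u (w p) =
      alongDeriv I I' x (fun q => mfderiv I I' x q (w q)) p u -
        mfderiv I I' x p (leviCivita I M w p u) := by
  rw [hN.alongDeriv_mfderiv hx hw]
  abel

lemma secondFundamentalForm_comm (p : M) (u v : TangentSpace I p) :
    secondFundamentalForm I I' x p u v = secondFundamentalForm I I' x p v u := by
  have hu : ContMDiffAt I I.tangent 1 (T% (extend E u)) p := contMDiffAt_extend ..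
  have hv : ContMDiffAt I I.tangent 1 (T% (extend E v)) p := contMDiffAt_extend ..
  have h := hN.alongDeriv_torsion_free hx.contMDiff hu hv
  rw [extend_apply_self, extend_apply_self] at h
  rw [secondFundamentalForm, secondFundamentalForm, ← sub_eq_zero, ← normalPart_sub, h,
    hx.normalPart_mfderiv]

lemma isNormalAt_secondFundamentalForm (p : M) (u v : TangentSpace I p) :
    IsNormalAt I I' x p (secondFundamentalForm I I' x p u v) :=
  hx.isNormalAt_normalPart _

lemma secondFundamentalForm_add_left (p : M) (u u' v : TangentSpace I p) :
    secondFundamentalForm I I' x p (u + u') v =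
      secondFundamentalForm I I' x p u v + secondFundamentalForm I I' x p u' v := by
  have hv : ContMDiffAt I I.tangent 1 (T% (extend E v)) p := contMDiffAt_extend ..
  rw [secondFundamentalForm, hN.alongDeriv_add_vector hx.contMDiff
    (hN.contMDiffAt_mfderiv_apply hx.contMDiff ENat.LEInfty.out hv), normalPart_add]
  rfl

lemma secondFundamentalForm_smul_left (p : M) (c : ℝ) (u v : TangentSpace I p) :
    secondFundamentalForm I I' x p (c • u) v = c • secondFundamentalForm I I' x p u v := by
  have hv : ContMDiffAt I I.tangent 1 (T% (extend E v)) p := contMDiffAt_extend ..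
  rw [secondFundamentalForm, hN.alongDeriv_smul_vector hx.contMDiff
    (hN.contMDiffAt_mfderiv_apply hx.contMDiff ENat.LEInfty.out hv), normalPart_smul]
  rfl

lemma inner_weingarten (p : M) (ξ : TangentSpace I' (x p)) (u v : TangentSpace I p) :
    inner ℝ (weingarten I I' x p ξ u) v = inner ℝ (secondFundamentalForm I I' x p u v) ξ := by
  let L : TangentSpace I p →ₗ[ℝ] ℝ :=
    { toFun := fun v => inner ℝ (secondFundamentalForm I I' x p u v) ξ
      map_add' := fun v v' => by
        rw [hN.secondFundamentalForm_comm hx, hN.secondFundamentalForm_add_left hx, inner_add_left,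
          hN.secondFundamentalForm_comm hx p v, hN.secondFundamentalForm_comm hx p v']
      map_smul' := fun c v => by
        rw [hN.secondFundamentalForm_comm hx, hN.secondFundamentalForm_smul_left hx,
          real_inner_smul_left, hN.secondFundamentalForm_comm hx p v]
        rfl }
  set b := stdOrthonormalBasis ℝ (TangentSpace I p)
  have h1 : L v = ∑ i, inner ℝ (b i) v * L (b i) := by
    conv_lhs => rw [← b.sum_repr' v]
    simp [map_sum]
  change _ = L v
  rw [h1, weingarten, sum_inner]
  refine Finset.sum_congr rfl fun i _ => ?_
  rw [real_inner_smul_left, mul_comm]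
  rfl

lemma inner_alongDeriv_of_isNormalAt {p : M} {ν : Π q : M, TangentSpace I' (x q)}
    (hν : ContMDiffAt I I'.tangent 1 (fun q => (⟨x q, ν q⟩ : TangentBundle I' N)) p)
    (hn : ∀ᶠ q in 𝓝 p, IsNormalAt I I' x q (ν q)) (u w : TangentSpace I p) :
    inner ℝ (alongDeriv I I' x ν p u) (mfderiv I I' x p w) =
      -inner ℝ (secondFundamentalForm I I' x p u w) (ν p) := by
  have hw : ContMDiffAt I I.tangent 1 (T% (extend E w)) p := contMDiffAt_extend ..
  have h1 := hN.alongDeriv_inner hx.contMDiff hν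
    (hN.contMDiffAt_mfderiv_apply hx.contMDiff ENat.LEInfty.out hw) u
  have h2 : (fun q => inner ℝ (ν q) (mfderiv I I' x q (extend E w q))) =ᶠ[𝓝 p] fun _ => (0 : ℝ) := by
    filter_upwards [hn] with q hq using hq _
  rw [mvfderiv_congr h2, mvfderiv_const, hN.alongDeriv_mfderiv hx hw, inner_add_right,
    hn.self_of_nhds, extend_apply_self, zero_add, real_inner_comm _ (ν p)] at h1
  have h3 : (0 : ℝ) = _ := h1
  linarith

lemma contMDiffAt_secondFundamentalForm {p : M} {u w : Π q : M, TangentSpace I q}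
    (hu : ContMDiffAt I I.tangent 1 (T% u) p) (hw : ContMDiffAt I I.tangent 2 (T% w) p) :
    ContMDiffAt I I'.tangent 1 (fun q =>
      (⟨x q, secondFundamentalForm I I' x q (u q) (w q)⟩ : TangentBundle I' N)) p := by
  have hW := hN.contMDiffAt_mfderiv_apply hx.contMDiff (m := 2) ENat.LEInfty.out hw
  have h1 := hN.contMDiffAt_along_sub hx.contMDiff ENat.LEInfty.out
    (hN.contMDiffAt_alongDeriv hx.contMDiff hW hu)
    (hN.contMDiffAt_mfderiv_apply hx.contMDiff (m := 1) ENat.LEInfty.out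
      (hN.contMDiffAt_leviCivita hx hu hw))
  refine h1.congr_of_eventuallyEq ?_
  filter_upwards [(contMDiffAt_iff_contMDiffAt_nhds (by simp)).1 hw] with q hq
  rw [hN.secondFundamentalForm_eq hx (hq.of_le (by norm_num))]

/-- The second derivative of a tangent field, split by the Gauss formula. -/
lemma alongDeriv_alongDeriv_mfderiv {p : M} {u v w : Π q : M, TangentSpace I q}
    (hv : ContMDiffAt I I.tangent 1 (T% v) p) (hw : ContMDiffAt I I.tangent 2 (T% w) p) :
    alongDeriv I I' x (fun q => alongDeriv I I' x (fun q => mfderiv I I' x q (w q)) q (v q)) p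
        (u p) =
      mfderiv I I' x p (leviCivita I M (fun q => leviCivita I M w q (v q)) p (u p)) +
        secondFundamentalForm I I' x p (u p) (leviCivita I M w p (v p)) +
        alongDeriv I I' x (fun q => secondFundamentalForm I I' x q (v q) (w q)) p (u p) := by
  have h1 : (1 : ℕ∞ω) ≤ ∞ := ENat.LEInfty.out
  have hW := hN.contMDiffAt_mfderiv_apply hx.contMDiff (m := 2) ENat.LEInfty.out hw
  have hS := hN.contMDiffAt_alongDeriv hx.contMDiff hW hv
  have hL := hN.contMDiffAt_leviCivita hx hv hw
  have hdL := hN.contMDiffAt_mfderiv_apply hx.contMDiff h1 hL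
  have hα := hN.contMDiffAt_secondFundamentalForm hx hv hw
  rw [← hN.alongDeriv_mfderiv hx hL, ← hN.alongDeriv_add_field hx.contMDiff hdL hα]
  refine hN.alongDeriv_congr hx.contMDiff hS (hN.contMDiffAt_along_add hx.contMDiff h1 hdL hα) ?_ _
  filter_upwards [(contMDiffAt_iff_contMDiffAt_nhds (by simp)).1 hw] with q hq
  exact hN.alongDeriv_mfderiv hx (hq.of_le (by norm_num)) (v q)

/-- The ambient curvature on tangent fields, split by the Gauss formula. -/
lemma curvature_alongDeriv_mfderiv {p : M} {u v w : Π q : M, TangentSpace I q}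
    (hu : ContMDiffAt I I.tangent 1 (T% u) p) (hv : ContMDiffAt I I.tangent 1 (T% v) p)
    (hw : ContMDiffAt I I.tangent 2 (T% w) p) :
    alongDeriv I I' x (fun q => alongDeriv I I' x (fun q => mfderiv I I' x q (w q)) q (v q)) p (u p)
      - alongDeriv I I' x (fun q => alongDeriv I I' x (fun q => mfderiv I I' x q (w q)) q (u q)) p
          (v p)
      - alongDeriv I I' x (fun q => mfderiv I I' x q (w q)) p (VectorField.mlieBracket I u v p) =
    mfderiv I I' x p (riemannCurvature I u v w p) +
      (secondFundamentalForm I I' x p (u p) (leviCivita I M w p (v p)) -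
        secondFundamentalForm I I' x p (v p) (leviCivita I M w p (u p)) -
        secondFundamentalForm I I' x p (VectorField.mlieBracket I u v p) (w p)) +
      (alongDeriv I I' x (fun q => secondFundamentalForm I I' x q (v q) (w q)) p (u p) -
        alongDeriv I I' x (fun q => secondFundamentalForm I I' x q (u q) (w q)) p (v p)) := by
  rw [hN.alongDeriv_alongDeriv_mfderiv hx hv hw, hN.alongDeriv_alongDeriv_mfderiv hx hu hw,
    hN.alongDeriv_mfderiv hx (hw.of_le (by norm_num)), riemannCurvature, curvature, map_sub, map_sub]
  abel

/-- The Gauss equation, in terms of the ambient curvature. -/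
theorem gauss_equation {p : M} {u v w : Π q : M, TangentSpace I q}
    (hu : ContMDiffAt I I.tangent 2 (T% u) p) (hv : ContMDiffAt I I.tangent 2 (T% v) p)
    (hw : ContMDiffAt I I.tangent 2 (T% w) p) (z : TangentSpace I p) :
    inner ℝ (riemannCurvature I u v w p) z =
      inner ℝ (alongDeriv I I' x
          (fun q => alongDeriv I I' x (fun q => mfderiv I I' x q (w q)) q (v q)) p (u p)
        - alongDeriv I I' x
          (fun q => alongDeriv I I' x (fun q => mfderiv I I' x q (w q)) q (u q)) p (v p)
        - alongDeriv I I' x (fun q => mfderiv I I' x q (w q)) p (VectorField.mlieBracket I u v p))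
        (mfderiv I I' x p z)
      + inner ℝ (secondFundamentalForm I I' x p (u p) z)
          (secondFundamentalForm I I' x p (v p) (w p))
      - inner ℝ (secondFundamentalForm I I' x p (u p) (w p))
          (secondFundamentalForm I I' x p (v p) z) := by
  have hu1 : ContMDiffAt I I.tangent 1 (T% u) p := hu.of_le (by norm_num)
  have hv1 : ContMDiffAt I I.tangent 1 (T% v) p := hv.of_le (by norm_num)
  have hα := fun a b => hN.isNormalAt_secondFundamentalForm hx p a b z
  rw [hN.curvature_alongDeriv_mfderiv hx hu1 hv1 hw]
  simp only [inner_add_left, inner_sub_left, hα, hx.inner_mfderiv]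
  rw [hN.inner_alongDeriv_of_isNormalAt hx (hN.contMDiffAt_secondFundamentalForm hx hv1 hw)
      (Filter.Eventually.of_forall fun q => hN.isNormalAt_secondFundamentalForm hx q _ _),
    hN.inner_alongDeriv_of_isNormalAt hx (hN.contMDiffAt_secondFundamentalForm hx hu1 hw)
      (Filter.Eventually.of_forall fun q => hN.isNormalAt_secondFundamentalForm hx q _ _),
    real_inner_comm (secondFundamentalForm I I' x p (v p) z)]
  ring

/-- The Codazzi equation, in terms of the ambient curvature. -/
theorem codazzi_equation {p : M} {u v w : Π q : M, TangentSpace I q}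
    (hu : ContMDiffAt I I.tangent 2 (T% u) p) (hv : ContMDiffAt I I.tangent 2 (T% v) p)
    (hw : ContMDiffAt I I.tangent 2 (T% w) p) :
    covSecondFundamentalForm I I' x u v w p - covSecondFundamentalForm I I' x v u w p =
      normalPart I I' x p (alongDeriv I I' x
          (fun q => alongDeriv I I' x (fun q => mfderiv I I' x q (w q)) q (v q)) p (u p)
        - alongDeriv I I' x
          (fun q => alongDeriv I I' x (fun q => mfderiv I I' x q (w q)) q (u q)) p (v p)
        - alongDeriv I I' x (fun q => mfderiv I I' x q (w q)) p
          (VectorField.mlieBracket I u v p)) := by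
  have hu1 : ContMDiffAt I I.tangent 1 (T% u) p := hu.of_le (by norm_num)
  have hv1 : ContMDiffAt I I.tangent 1 (T% v) p := hv.of_le (by norm_num)
  have hα := fun a b => (hN.isNormalAt_secondFundamentalForm hx p a b).normalPart_eq
  have hbr : secondFundamentalForm I I' x p (VectorField.mlieBracket I u v p) (w p) =
      secondFundamentalForm I I' x p (leviCivita I M v p (u p)) (w p) -
        secondFundamentalForm I I' x p (leviCivita I M u p (v p)) (w p) := by
    rw [eq_sub_iff_add_eq, ← hN.secondFundamentalForm_add_left hx,
      ← leviCivita_torsion_free (hu1.mdifferentiableAt one_ne_zero)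
        (hv1.mdifferentiableAt one_ne_zero), sub_add_cancel]
  rw [hN.curvature_alongDeriv_mfderiv hx hu1 hv1 hw]
  simp only [normalPart_add, normalPart_sub, hα, hx.normalPart_mfderiv, hbr,
    covSecondFundamentalForm, normalConnection]
  abel

lemma tangentPart_alongDeriv_of_isNormalAt {p : M} {ξ : Π q : M, TangentSpace I' (x q)}
    (hξ : ContMDiffAt I I'.tangent 1 (fun q => (⟨x q, ξ q⟩ : TangentBundle I' N)) p)
    (hn : ∀ᶠ q in 𝓝 p, IsNormalAt I I' x q (ξ q)) (u : TangentSpace I p) :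
    tangentPart I I' x p (alongDeriv I I' x ξ p u) = -weingarten I I' x p (ξ p) u := by
  refine ext_inner_right ℝ fun a => ?_
  rw [inner_tangentPart, hN.inner_alongDeriv_of_isNormalAt hx hξ hn, inner_neg_left,
    hN.inner_weingarten hx]

/-- The second derivative of a normal field, split by the Weingarten formula. -/
lemma inner_alongDeriv_alongDeriv_of_isNormalAt {p : M} {ξ : Π q : M, TangentSpace I' (x q)}
    (hξ : ContMDiffAt I I'.tangent 2 (fun q => (⟨x q, ξ q⟩ : TangentBundle I' N)) p)
    (hn : ∀ᶠ q in 𝓝 p, IsNormalAt I I' x q (ξ q)) {u v : Π q : M, TangentSpace I q}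
    (hv : ContMDiffAt I I.tangent 1 (T% v) p) {η : TangentSpace I' (x p)}
    (hη : IsNormalAt I I' x p η) :
    inner ℝ (alongDeriv I I' x (fun q => alongDeriv I I' x ξ q (v q)) p (u p)) η =
      inner ℝ (normalConnection I I' x (fun q => normalConnection I I' x ξ q (v q)) p (u p)) η -
        inner ℝ (weingarten I I' x p η (u p)) (weingarten I I' x p (ξ p) (v p)) := by
  have h1 : (1 : ℕ∞ω) ≤ ∞ := ENat.LEInfty.out
  have hS := hN.contMDiffAt_alongDeriv hx.contMDiff hξ hv
  have hT := hN.contMDiffAt_tangentPart hx h1 hS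
  have hdT := hN.contMDiffAt_mfderiv_apply hx.contMDiff h1 hT
  have hn' := hN.contMDiffAt_along_sub hx.contMDiff h1 hS hdT
  have h2 := hN.alongDeriv_congr hx.contMDiff hS
    (hN.contMDiffAt_along_add hx.contMDiff h1 hdT hn')
    (Filter.Eventually.of_forall fun q => by abel) (u p)
  have hξ1 : ContMDiffAt I I'.tangent 1 (fun q => (⟨x q, ξ q⟩ : TangentBundle I' N)) p :=
    hξ.of_le (by norm_num)
  rw [h2, hN.alongDeriv_add_field hx.contMDiff hdT hn', hN.alongDeriv_mfderiv hx hT,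
    hN.tangentPart_alongDeriv_of_isNormalAt hx hξ1 hn, inner_add_left, inner_add_left,
    hη.inner_mfderiv_left, ← hN.inner_weingarten hx, inner_neg_right, ← inner_normalPart_left hη]
  change _ + inner ℝ (normalConnection I I' x (fun q => normalConnection I I' x ξ q (v q)) p (u p))
    η = _
  ring

/-- The Ricci equation, in terms of the ambient curvature. -/
theorem ricci_equation {p : M} {ξ : Π q : M, TangentSpace I' (x q)}
    (hξ : ContMDiffAt I I'.tangent 2 (fun q => (⟨x q, ξ q⟩ : TangentBundle I' N)) p)
    (hn : ∀ᶠ q in 𝓝 p, IsNormalAt I I' x q (ξ q)) {u v : Π q : M, TangentSpace I q}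
    (hu : ContMDiffAt I I.tangent 1 (T% u) p) (hv : ContMDiffAt I I.tangent 1 (T% v) p)
    {η : TangentSpace I' (x p)} (hη : IsNormalAt I I' x p η) :
    inner ℝ (normalCurvature I I' x u v ξ p) η =
      inner ℝ (alongDeriv I I' x (fun q => alongDeriv I I' x ξ q (v q)) p (u p)
        - alongDeriv I I' x (fun q => alongDeriv I I' x ξ q (u q)) p (v p)
        - alongDeriv I I' x ξ p (VectorField.mlieBracket I u v p)) η
      + inner ℝ (weingarten I I' x p (ξ p) (weingarten I I' x p η (u p))
        - weingarten I I' x p η (weingarten I I' x p (ξ p) (u p))) (v p) := by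
  have hA : ∀ (ν : TangentSpace I' (x p)) (a b : TangentSpace I p),
      inner ℝ (weingarten I I' x p ν a) b = inner ℝ a (weingarten I I' x p ν b) := by
    intro ν a b
    rw [hN.inner_weingarten hx, hN.secondFundamentalForm_comm hx, ← hN.inner_weingarten hx,
      real_inner_comm]
  rw [inner_sub_left, inner_sub_left, inner_sub_left,
    hN.inner_alongDeriv_alongDeriv_of_isNormalAt hx hξ hn hv hη,
    hN.inner_alongDeriv_alongDeriv_of_isNormalAt hx hξ hn hu hη,
    hA (ξ p) (weingarten I I' x p η (u p)), hA η (weingarten I I' x p (ξ p) (u p)),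
    ← inner_normalPart_left (V := alongDeriv I I' x ξ p _) hη, normalCurvature, curvature,
    inner_sub_left, inner_sub_left,
    real_inner_comm (weingarten I I' x p (ξ p) (u p)) (weingarten I I' x p η (v p))]
  change _ = _ - inner ℝ (normalConnection I I' x ξ p (VectorField.mlieBracket I u v p)) η + _
  ring

end IsWarpedIsometry

end FundamentalEquations

namespace WarpedProduct

variable {n : ℕ} {J : TopologicalSpace.Opens ℝ} {f : WarpingFunction J}

/-- The space `ℝ × ℝⁿ⁺¹` with its Euclidean inner product. -/
abbrev AmbientSpace (n : ℕ) : Type := WithLp 2 (ℝ × EuclideanSpace ℝ (Fin (n + 1)))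

/-- The first unit vector of `ℝ × ℝⁿ⁺¹`. -/
def axis (n : ℕ) : AmbientSpace n := WithLp.toLp 2 (1, 0)

/-- The inclusion of `ℝⁿ⁺¹` in `ℝ × ℝⁿ⁺¹`. -/
def inclusion (n : ℕ) : EuclideanSpace ℝ (Fin (n + 1)) →L[ℝ] AmbientSpace n :=
  (WithLp.prodContinuousLinearEquiv 2 ℝ ℝ
    (EuclideanSpace ℝ (Fin (n + 1)))).symm.toContinuousLinearMap.comp
    (ContinuousLinearMap.inr ℝ ℝ (EuclideanSpace ℝ (Fin (n + 1))))

lemma inclusion_apply (a : EuclideanSpace ℝ (Fin (n + 1))) :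
    inclusion n a = WithLp.toLp 2 (0, a) := rfl

lemma inner_inclusion (a b : EuclideanSpace ℝ (Fin (n + 1))) :
    inner ℝ (inclusion n a) (inclusion n b) = inner ℝ a b := by
  simp [inclusion_apply, WithLp.prod_inner_apply]

lemma inner_direction_self (y : WarpedProduct n f) :
    inner ℝ y.direction y.direction = (1 : ℝ) := by
  rw [real_inner_self_eq_norm_sq, direction, norm_eq_of_mem_sphere]
  norm_num

lemma mvfderiv_inclusion_direction (y : WarpedProduct n f) (a : TangentSpace (warpedModel n) y) :
    mvfderiv (warpedModel n) (fun y : WarpedProduct n f => inclusion n y.direction) y a =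
      inclusion n (mvfderiv (warpedModel n) direction y a) := by
  have h := mfderiv_comp_apply (f := direction) (g := inclusion n) y
    (inclusion n).differentiableAt.mdifferentiableAt
    (contMDiff_direction.mdifferentiableAt (by simp)) a
  rw [ContinuousLinearMap.mfderiv_eq] at h
  exact h

variable (n f) in
lemma isWarpedMap : IsWarpedMap (warpedModel n) J (axis n) (height (f := f))
    (fun y : WarpedProduct n f => inclusion n y.direction) where
  height := contMDiff_height
  mem y := y.1.2
  sphere := (inclusion n).contMDiff.comp contMDiff_direction
  inner_axis := by simp [axis]
  inner_axis_sphere y := by simp [axis, inclusion_apply, WithLp.prod_inner_apply]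
  inner_sphere y := by rw [inner_inclusion, inner_direction_self]

lemma exists_mvfderiv_direction (y : WarpedProduct n f) {s : EuclideanSpace ℝ (Fin (n + 1))}
    (hs : inner ℝ y.direction s = (0 : ℝ)) (t : ℝ) : ∃ a : TangentSpace (warpedModel n) y,
      mvfderiv (warpedModel n) height y a = t ∧ mvfderiv (warpedModel n) direction y a = s := by
  have : Fact (Module.finrank ℝ (EuclideanSpace ℝ (Fin (n + 1))) = n + 1) := ⟨by simp⟩
  have h : s ∈ (ℝ ∙ (y.2 : EuclideanSpace ℝ (Fin (n + 1))))ᗮ :=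
    Submodule.mem_orthogonal_singleton_iff_inner_right.2 hs
  rw [← range_mvfderiv_subtypeVal (n := n) y.2] at h
  obtain ⟨b, hb⟩ := h
  refine ⟨((t, b) : ℝ × EuclideanSpace ℝ (Fin n)), mvfderiv_height y _, ?_⟩
  exact (mvfderiv_direction y _).trans hb

variable (n f) in
/-- The differential of the inclusion of the warped product identifies its tangent spaces with the
orthogonal complements of the points of the sphere. -/
lemma isWarpedIsometry : IsWarpedIsometry (warpedModel n) f (axis n) height
    (fun y : WarpedProduct n f => inclusion n y.direction) where
  toIsWarpedMap := isWarpedMap n f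
  isometry y a b := by
    rw [(isWarpedMap n f).inner_warpedForm, mvfderiv_inclusion_direction,
      mvfderiv_inclusion_direction, inner_inclusion, ← warpedInner_apply]
    rfl
  surjective y s hs := by
    have hf : f.toFun y.height ≠ 0 := (f.pos _ y.1.2).ne'
    have h1 : inner ℝ y.direction s.snd = (0 : ℝ) := by
      simpa [inclusion_apply, WithLp.prod_inner_apply] using hs
    obtain ⟨a, ha, ha'⟩ := exists_mvfderiv_direction y (s := (f.toFun y.height)⁻¹ • s.snd)
      (by rw [real_inner_smul_right, h1, mul_zero]) s.fst
    refine ⟨a, ?_⟩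
    rw [warpedForm_apply, mvfderiv_inclusion_direction, ha, ha', map_smul, smul_smul,
      mul_inv_cancel₀ hf, one_smul]
    rw [axis, inclusion_apply, ← WithLp.toLp_smul, ← WithLp.toLp_add]
    simp
    rfl

lemma warpedForm_partialT (y : WarpedProduct n f) :
    warpedForm (warpedModel n) f (axis n) height
      (fun y : WarpedProduct n f => inclusion n y.direction) y (partialT y) = axis n := by
  rw [warpedForm_apply, mvfderiv_inclusion_direction, mvfderiv_direction_partialT,
    mvfderiv_height_partialT]
  simp

end WarpedProduct

end SubmanifoldGeometry

end

theorem proposition3p2 {n k : ℕ} {J : TopologicalSpace.Opens ℝ} (f : WarpingFunction J)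
    {M : Type*} [TopologicalSpace M] [ChartedSpace (EuclideanSpace ℝ (Fin k)) M]
    [IsManifold (𝓡 k) ∞ M]
    [RiemannianBundle (fun p : M => TangentSpace (𝓡 k) p)]
    [IsContMDiffRiemannianBundle (𝓡 k) ∞ (EuclideanSpace ℝ (Fin k))
      (fun p : M => TangentSpace (𝓡 k) p)]
    (x : M → WarpedProduct n f) (hx : IsIsometricImmersion (𝓡 k) (warpedModel n) x)
    -- `T` and `ϱ` are the tangent and normal components of `∂_t`
    (T : Π p : M, TangentSpace (𝓡 k) p)
    (hT : T = fun p => tangentPart (𝓡 k) (warpedModel n) x p (WarpedProduct.partialT (x p)))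
    (ϱ : Π p : M, TangentSpace (warpedModel n) (x p))
    (hϱ : ϱ = fun p => normalPart (𝓡 k) (warpedModel n) x p (WarpedProduct.partialT (x p)))
    -- a point `p`, local vector fields `u, v, w` and a vector `z` tangent to `M`
    (p : M) (u v w : Π q : M, TangentSpace (𝓡 k) q) (z : TangentSpace (𝓡 k) p)
    (hu : ContMDiffAt (𝓡 k) (𝓡 k).tangent ∞
      (fun q => (⟨q, u q⟩ : TangentBundle (𝓡 k) M)) p)
    (hv : ContMDiffAt (𝓡 k) (𝓡 k).tangent ∞
      (fun q => (⟨q, v q⟩ : TangentBundle (𝓡 k) M)) p)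
    (hw : ContMDiffAt (𝓡 k) (𝓡 k).tangent ∞
      (fun q => (⟨q, w q⟩ : TangentBundle (𝓡 k) M)) p)
    -- a local normal field `ξ` and a normal vector `η`
    (ξ : Π q : M, TangentSpace (warpedModel n) (x q)) (η : TangentSpace (warpedModel n) (x p))
    (hξ : ContMDiffAt (𝓡 k) (warpedModel n).tangent ∞
      (fun q => (⟨x q, ξ q⟩ : TangentBundle (warpedModel n) (WarpedProduct n f))) p)
    (hξn : ∀ᶠ q in 𝓝 p, IsNormalAt (𝓡 k) (warpedModel n) x q (ξ q))
    (hη : IsNormalAt (𝓡 k) (warpedModel n) x p η) :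
    -- Gauss equation
    (inner ℝ (riemannCurvature (𝓡 k) u v w p) z =
      f.lam (x p).height * bracket4 (u p) (v p) (w p) z
      + f.mu (x p).height * (inner ℝ (w p) (T p) * bracket4 (v p) (u p) (T p) z
        + bracket4 (v p) (u p) (w p) (T p) * inner ℝ (T p) z)
      + inner ℝ (secondFundamentalForm (𝓡 k) (warpedModel n) x p (u p) z)
          (secondFundamentalForm (𝓡 k) (warpedModel n) x p (v p) (w p))
      - inner ℝ (secondFundamentalForm (𝓡 k) (warpedModel n) x p (u p) (w p))
          (secondFundamentalForm (𝓡 k) (warpedModel n) x p (v p) z)) ∧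
    -- Codazzi equation
    (covSecondFundamentalForm (𝓡 k) (warpedModel n) x u v w p
        - covSecondFundamentalForm (𝓡 k) (warpedModel n) x v u w p =
      (f.mu (x p).height * bracket4 (v p) (u p) (w p) (T p)) • ϱ p) ∧
    -- Ricci equation
    (inner ℝ (normalCurvature (𝓡 k) (warpedModel n) x u v ξ p) η =
      inner ℝ (weingarten (𝓡 k) (warpedModel n) x p (ξ p)
          (weingarten (𝓡 k) (warpedModel n) x p η (u p))
        - weingarten (𝓡 k) (warpedModel n) x p η
          (weingarten (𝓡 k) (warpedModel n) x p (ξ p) (u p))) (v p)) := by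
  have hN := WarpedProduct.isWarpedIsometry n f
  have hτ := WarpedProduct.warpedForm_partialT (x p)
  have h1 : (1 : ℕ∞ω) ≤ ∞ := ENat.LEInfty.out
  have h2 : (2 : ℕ∞ω) ≤ ∞ := ENat.LEInfty.out
  have hcurv := fun W => hN.inner_curvature_alongDeriv hx.contMDiff
    (hN.contMDiffAt_mfderiv_apply hx.contMDiff h2 (hw.of_le h2)) (hu.of_le h1) (hv.of_le h1) hτ W
  have hτT : ∀ a : TangentSpace (𝓡 k) p,
      inner ℝ (WarpedProduct.partialT (x p)) (mfderiv (𝓡 k) (warpedModel n) x p a) =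
        inner ℝ (T p) a := fun a => by rw [hT, inner_tangentPart]
  have hTτ : ∀ a : TangentSpace (𝓡 k) p,
      inner ℝ (mfderiv (𝓡 k) (warpedModel n) x p a) (WarpedProduct.partialT (x p)) =
        inner ℝ a (T p) := fun a => by rw [real_inner_comm, hτT, real_inner_comm]
  refine ⟨?_, ?_, ?_⟩
  · rw [hN.gauss_equation hx (hu.of_le h2) (hv.of_le h2) (hw.of_le h2), hcurv]
    simp only [bracket4_eq, hx.inner_mfderiv, hτT, hTτ]
  · rw [hN.codazzi_equation hx (hu.of_le h2) (hv.of_le h2) (hw.of_le h2)]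
    refine ext_inner_right ℝ fun X => ?_
    rw [hx.inner_normalPart_comm, hcurv, real_inner_smul_left, hϱ, hx.inner_normalPart_comm]
    have hX := (hx.isNormalAt_normalPart (p := p) X).inner_mfderiv_left
    simp only [bracket4_eq, hX, hx.inner_mfderiv, hTτ]
    ring
  · have hξp := hξn.self_of_nhds
    rw [hN.ricci_equation hx (hξ.of_le h2) hξn (hu.of_le h1) (hv.of_le h1) hη,
      hN.inner_curvature_alongDeriv hx.contMDiff (hξ.of_le h2) (hu.of_le h1) (hv.of_le h1) hτ]
    simp only [bracket4_eq, hη.inner_mfderiv_left, hξp.inner_mfderiv_left]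
    ring
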